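/- **Setting.** Let $G$ be a locally compact second countable (Hausdorff) group with Borel $\sigma$-algebra $\mathfrak G$ and right Haar measure $\lambda$, and let $\rho$ be a probability measure on $G$ equivalent to $\lambda$. Let $\Gamma\le G$ be a countable subgroup and $\mu$ a probability measure on $\Gamma$ whose support generates $\Gamma$ as a semigroup. All $L^\infty$ spaces are real. Denote by $H^\infty_\lambda(G)$ the space of $f\in L^\infty(G,\lambda)$ with $f(g)=\int_\Gamma f(g\gamma)\,d\mu(\gamma)$ for $\lambda$-a.e. $g$; $H^\infty(\Gamma)$ is defined in the same way with the counting measure on $\Gamma$. Let $(Y,\nu)$ be a measurable space with a probability measure, with a measurable $G$-action $(g,y)\mapsto g\cdot y$ such that $\mu*\nu=\nu$. The action may be defined only almost everywhere with respect to $\rho*\nu$ (the law of $g\cdot y$ under $\rho\times\nu$): for each $g$ the point $g\cdot y$ is then defined for a.e. $y$, translation by $g$ preserves null sets, and the action laws hold a.e. It acts on functions by $(g*\varphi)(y)=\varphi(g\cdot y)$. Then $(Y,\nu)$ is called the *$G$-Poisson boundary* if the Poisson transform $\varphi\mapsto f_\varphi$, $f_\varphi(g)=\int (g*\varphi)\,d\nu$,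 is a well-defined linear isometry of $L^\infty(Y,\rho*\nu)$ onto $H^\infty_\lambda(G)$. The $\Gamma$-Poisson boundary is defined in the same way, with $\Gamma$, the counting measure and a fully supported probability measure on $\Gamma$ in place of $G,\lambda,\rho$. Let $(X,\mathfrak X,\nu)$ be a standard Borel space with a measurable $\Gamma$-action that is the $\Gamma$-Poisson boundary of $(\Gamma,\mu)$. Let $\Gamma$ act on $G\times X$ by $\gamma\star(g,x)=(g\gamma^{-1},\gamma\cdot x)$, and let $\mathfrak I$ be the $\sigma$-algebra of the sets in $\mathfrak G\times\mathfrak X$ that are $\rho\times\nu$-almost surely $\star$-invariant. **Statement.** Let $\Delta\in\mathfrak G\times\mathfrak X$ be a measurable fundamental domain of the $\star$-action, i.e. $\rho\times\nu\big((G\times X)\setminus\Gamma\star\Delta\big)=0$ and $\rho\times\nu\big(\Delta\cap\bigcup_{\gamma\ne e}\gamma\star\Delta\big)=0$, and let $\mathfrak D$ be the restriction of $\mathfrak G\times\mathfrak X$ to $\Delta$. Functions on $\Delta$ are extended by $0$ in products with $1_\Delta$. 1. The map $\varphi\mapsto\sum_{\gamma\in\Gamma}(\varphi 1_\Delta)(\gamma\star\,\cdot\,)$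 is a linear isometry of $L^\infty(\Delta,\mathfrak D,\rho\times\nu)$ onto $L^\infty(G\times X,\mathfrak I,\rho\times\nu)$. 2. Sending $(g_0,(g,x))$ to the point of $\Delta$ of the form $\gamma\star(g_0g,x)$, $\gamma\in\Gamma$, defines an a.e. action of $G$ on $(\Delta,\mathfrak D,\rho\times\nu)$. On functions it is given, for each $g_0$ and almost every $(g,x)\in\Delta$, by $$(g_0*\varphi)(g,x)=\sum_{\gamma\in\Gamma}(\varphi1_\Delta)(g_0g\gamma^{-1},\gamma\cdot x).$$ 3. Suppose in addition that for $\nu$-almost every $x$ the $\star$-orbit of $(e,x)$ meets $\Delta$ in exactly one point. Then $$\widetilde\nu(\varphi)=\sum_{\gamma\in\Gamma}\int\varphi(\gamma^{-1},\gamma\cdot x)\,1_\Delta(\gamma^{-1},\gamma\cdot x)\,d\nu(x)\qquad(\varphi \text{ bounded measurable on }\Delta)$$ defines a $\mu$-invariant probability measure on $\Delta$, the measure $\rho*\widetilde\nu$ is equivalent to the restriction of $\rho\times\nu$ to $\Delta$, and $(\Delta,\mathfrak D)$, with the action of part 2 and the measure $\widetilde\nu$, is the $G$-Poisson boundary. 4.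 The additional condition in part 3 can always be achieved by changing $\Delta$ on a $\rho\times\nu$-null set: there is a measurable fundamental domain $\Delta'$ that satisfies it and agrees with $\Delta$ up to a $\rho\times\nu$-null set. -/

import Mathlib

open MeasureTheory ProbabilityTheory
open scoped ENNReal

noncomputable section

section General

variable {H Y : Type*} [Group H] [MeasurableSpace H] [MeasurableSpace Y]

/-- `f` is `μ`-harmonic on `(H, lam)`: `f g = ∫ f (g h) dμ(h)` for `lam`-almost every `g`. -/
def IsHarmonic (lam μ : Measure H) (f : H → ℝ) : Prop :=
  ∀ᵐ g ∂lam, f g = ∫ h, f (g * h) ∂μ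

/-- The space of `μ`-harmonic functions in `L^∞(H, lam)`. -/
def harmonicLinfty (lam μ : Measure H) : Set (Lp ℝ ∞ lam) :=
  {f | IsHarmonic lam μ f}

/-- An action of `H` on the measure space `(Y, m)`, defined almost everywhere. The action is
given by a jointly measurable family of measures `κ (g, y)`, where `κ (g, y)` is the point mass at
`g · y`. For each `g` the point `g · y` has to exist for `m`-almost every `y`, the null sets of `m`
are preserved, and the action laws hold almost everywhere. It acts on functions by
`(g * φ) y = ∫ φ dκ (g, y) = φ (g · y)`. -/
structure IsNearAction (κ : Kernel (H × Y) Y) (m : Measure Y) : Prop where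
  point : ∀ g : H, ∀ᵐ y ∂m, ∃ z : Y, κ (g, y) = Measure.dirac z
  null : ∀ (g : H) (A : Set Y), MeasurableSet A → m A = 0 → ∀ᵐ y ∂m, κ (g, y) A = 0
  one : ∀ᵐ y ∂m, κ (1, y) = Measure.dirac y
  mul : ∀ g h : H, ∀ᵐ y ∂m, κ (g * h, y) = (κ (h, y)).bind (fun z => κ (g, z))

/-- The kernel `(g, y) ↦ δ_{g • y}` of a measurable action defined everywhere. -/
def actionKernel (H Y : Type*) [Group H] [MeasurableSpace H] [MeasurableSpace Y] [MulAction H Y]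
    [MeasurableSMul₂ H Y] : Kernel (H × Y) Y :=
  Kernel.deterministic (fun p : H × Y => p.1 • p.2) measurable_smul

/-- The convolution `ρ * ν`, that is the law of `g · y` when `(g, y)` has law `ρ × ν`. -/
def actConv (κ : Kernel (H × Y) Y) (ρ : Measure H) (ν : Measure Y) : Measure Y :=
  (ρ.prod ν).bind κ

/-- The Poisson transform `f_φ(g) = ∫ φ (g · y) dν(y)`. -/
def poissonTransform (κ : Kernel (H × Y) Y) (ν : Measure Y) (φ : Y → ℝ) (g : H) : ℝ :=
  ∫ y, (∫ z, φ z ∂κ (g, y)) ∂ν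

/-- `(Y, ν)`, with the action of `H` given by `κ`, is the `(H, μ)`-Poisson boundary: `ν` is a
`μ`-invariant probability measure, and the Poisson transform is a linear isometry of
`L^∞(Y, ρ * ν)` onto the space of `μ`-harmonic functions in `L^∞(H, lam)`. Here `lam` is the
reference (Haar) measure on `H` and `ρ` a probability measure equivalent to it. -/
structure IsPoissonBoundary (lam ρ μ : Measure H) (κ : Kernel (H × Y) Y) (ν : Measure Y) :
    Prop where
  prob : IsProbabilityMeasure ν
  action : IsNearAction κ (actConv κ ρ ν)
  invariant : actConv κ μ ν = ν
  isometry : ∃ P : Lp ℝ ∞ (actConv κ ρ ν) →ₗᵢ[ℝ] Lp ℝ ∞ lam,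
    (∀ (φ : Y → ℝ) (hφ : MemLp φ ∞ (actConv κ ρ ν)),
      P (hφ.toLp φ) =ᵐ[lam] poissonTransform κ ν φ) ∧
    Set.range P = harmonicLinfty lam μ

end General

section Star

variable {G X : Type*} [Group G] {Γ : Subgroup G} [MulAction Γ X]

/-- The action `γ ⋆ (g, x) = (g γ⁻¹, γ • x)` of `Γ` on `G × X`. -/
def starAct (γ : Γ) (p : G × X) : G × X := (p.1 * (γ : G)⁻¹, γ • p.2)

variable [MeasurableSpace G] [MeasurableSpace X]

/-- `Δ` is a measurable fundamental domain of the `⋆`-action for the measure `m` on `G × X`. -/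
structure IsStarFundamentalDomain (Γ : Subgroup G) [MulAction Γ X] (m : Measure (G × X))
    (Δ : Set (G × X)) : Prop where
  measurableSet : MeasurableSet Δ
  covers : m (Set.univ \ ⋃ γ : Γ, starAct γ '' Δ) = 0
  disjoint : m (Δ ∩ ⋃ γ : Γ, ⋃ _ : γ ≠ 1, starAct γ '' Δ) = 0

/-- For `ν`-almost every `x`, the `⋆`-orbit of `(e, x)` meets `Δ` exactly once. -/
def MeetsIdentityFibre (Γ : Subgroup G) [MulAction Γ X] (ν : Measure X)
    (Δ : Set (G × X)) : Prop :=
  ∀ᵐ x ∂ν, ∃! γ : Γ, starAct γ ((1 : G), x) ∈ Δ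

/-- The `σ`-algebra of the measurable sets that are `m`-almost surely invariant under the
`⋆`-action. -/
@[reducible] def invariantSigma (Γ : Subgroup G) [MulAction Γ X] (m : Measure (G × X)) :
    MeasurableSpace (G × X) where
  MeasurableSet' A := MeasurableSet A ∧ ∀ᵐ p ∂m, ∀ γ : Γ, (starAct γ p ∈ A ↔ p ∈ A)
  measurableSet_empty := ⟨MeasurableSet.empty, by simp⟩
  measurableSet_compl A hA := by
    refine ⟨hA.1.compl, ?_⟩
    filter_upwards [hA.2] with p hp γ
    simp [hp γ]
  measurableSet_iUnion A hA := by
    refine ⟨MeasurableSet.iUnion fun i => (hA i).1, ?_⟩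
    filter_upwards [ae_all_iff.2 fun i => (hA i).2] with p hp γ
    simp [hp _ γ]

/-- The restriction of a measure on `G × X` to the measurable space `Δ`. -/
def onDomain (m : Measure (G × X)) (Δ : Set (G × X)) : Measure Δ :=
  m.comap Subtype.val

/-- The extension `φ 1_Δ` by zero of a function on `Δ`. -/
def zeroExt {Δ : Set (G × X)} (φ : Δ → ℝ) : G × X → ℝ :=
  Function.extend Subtype.val φ 0

/-- The measure `ν̃(A) = ∑_γ ∫ 1_A(γ⁻¹, γ x) dν(x)` on `Δ`. -/
def nuTilde (Γ : Subgroup G) [MulAction Γ X] (ν : Measure X) (Δ : Set (G × X)) : Measure Δ :=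
  onDomain (Measure.sum fun γ : Γ => ν.map fun x => starAct γ ((1 : G), x)) Δ

variable [MeasurableMul₂ G]

theorem measurable_star_translate {Γ : Subgroup G} [MulAction Γ X] [MeasurableSMul₂ Γ X]
    {Δ : Set (G × X)} (γ : Γ) :
    Measurable (fun q : G × Δ => starAct γ (q.1 * q.2.1.1, q.2.1.2)) := by
  unfold starAct
  have h : Measurable (fun q : G × Δ => (q.2 : G × X)) := measurable_subtype_coe.comp measurable_snd
  exact ((measurable_fst.mul h.fst).mul_const _).prodMk (h.snd.const_smul γ)

/-- The induced action of `G` on `Δ`: the measure `κ (g₀, (g, x))` is the sum of the point masses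
at the points `γ ⋆ (g₀ g, x)`, `γ ∈ Γ`, that lie in `Δ`. -/
def inducedKernel (Γ : Subgroup G) [Countable Γ] [MulAction Γ X]
    [MeasurableSMul₂ Γ X] {Δ : Set (G × X)} (hΔ : MeasurableSet Δ) : Kernel (G × Δ) Δ :=
  Kernel.comapRight
    (Kernel.sum fun γ : Γ =>
      Kernel.deterministic (fun q : G × Δ => starAct γ (q.1 * q.2.1.1, q.2.1.2))
        (measurable_star_translate γ))
    (MeasurableEmbedding.subtype_coe hΔ)

end Star

end

/-! Since Δ meets almost every ⋆-orbit exactly once, points of Δ stand for orbits and functions on Δ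
for ⋆-invariant functions on G × X (`IsStarFundamentalDomain.ae_exists_isOrbitPoint`). Left
translation by G commutes with ⋆, so it descends to Δ. Instead of choosing the point of Δ on each
orbit, the proof uses `orbitKernel`, which is ⋆-invariant everywhere and a Dirac mass almost
everywhere.

For the boundary, ν̃ is the image of δ_e × ν under this kernel. If F is the invariant lift of φ, the
Poisson transform of φ is f(g) = ∫ F(g, x) dν(x) for almost every g
(`MeetsIdentityFibre.poissonTransform_inducedKernel`). Invariance reads F(gγ, x) = F(g, γx), so for
fixed g the function γ ↦ f(gγ) is the Γ-Poisson transform of F(g, ·). The norm equality therefore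
comes, fibre by fibre, from the Γ-boundary, and harmonicity from the stationarity of ν.

Conversely, a bounded harmonic f gives on almost every coset gΓ a bounded harmonic function on Γ,
hence a function F(g, ·) on X. It has to be chosen measurably in g
(`IsPoissonBoundary.exists_measurable_transform_eq`); its invariance is then forced by the
injectivity of the Γ-transform (`IsPoissonBoundary.exists_invariant_of_isHarmonic`).

The fibre over e needs separate care because it may be null for ρ × ν while ν̃ is built from it.
When it is null, so is all of Γ × X, and Δ can be redefined there. -/

/-! ### Linear isometries between L^∞ spaces -/

section LpTop

variable {α β : Type*} {mα : MeasurableSpace α} {mβ : MeasurableSpace β}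
  {μ : Measure α} {ν : Measure β}

theorem Lp_top_norm_le_iff (f : Lp ℝ ∞ μ) {C : ℝ} (hC : 0 ≤ C) :
    ‖f‖ ≤ C ↔ ∀ᵐ x ∂μ, |f x| ≤ C := by
  have hfin : eLpNormEssSup f μ ≠ ∞ := by
    have := Lp.eLpNorm_ne_top f
    rwa [eLpNorm_exponent_top] at this
  rw [Lp.norm_def, eLpNorm_exponent_top]
  constructor
  · intro h
    filter_upwards [ae_le_eLpNormEssSup (f := f) (μ := μ)] with x hx
    have h2 := (ENNReal.toReal_le_toReal (by simp) hfin).2 hx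
    rw [toReal_enorm, Real.norm_eq_abs] at h2
    exact h2.trans h
  · intro h
    have := eLpNormEssSup_le_of_ae_bound (μ := μ) (f := f) (C := C) (by simpa using h)
    exact ENNReal.toReal_le_of_le_ofReal hC this

/-- Orbit sums and Poisson transforms are formulas on honest functions; this passes them to classes.
The isometry is asked for as an equivalence of almost sure bounds, each half of which is later
proved separately. -/
theorem exists_linearIsometry_of_ae (T : (α → ℝ) → β → ℝ)
    (hmem : ∀ φ, MemLp φ ∞ μ → MemLp (T φ) ∞ ν)
    (hcongr : ∀ φ ψ, φ =ᵐ[μ] ψ → T φ =ᵐ[ν] T ψ)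
    (hadd : ∀ φ ψ, MemLp φ ∞ μ → MemLp ψ ∞ μ → T (φ + ψ) =ᵐ[ν] T φ + T ψ)
    (hsmul : ∀ (c : ℝ) φ, MemLp φ ∞ μ → T (c • φ) =ᵐ[ν] c • T φ)
    (hnorm : ∀ φ, MemLp φ ∞ μ → ∀ C : ℝ, 0 ≤ C →
      ((∀ᵐ x ∂ν, |T φ x| ≤ C) ↔ ∀ᵐ x ∂μ, |φ x| ≤ C)) :
    ∃ P : Lp ℝ ∞ μ →ₗᵢ[ℝ] Lp ℝ ∞ ν,
      ∀ (φ : α → ℝ) (hφ : MemLp φ ∞ μ), P (hφ.toLp φ) =ᵐ[ν] T φ := by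
  let P₀ : Lp ℝ ∞ μ →ₗ[ℝ] Lp ℝ ∞ ν :=
    { toFun := fun φ => MemLp.toLp (T φ) (hmem φ (Lp.memLp φ))
      map_add' := fun φ ψ => by
        rw [← MemLp.toLp_add]
        exact MemLp.toLp_congr _ _ ((hcongr _ _ (Lp.coeFn_add φ ψ)).trans
          (hadd _ _ (Lp.memLp φ) (Lp.memLp ψ)))
      map_smul' := fun c φ => by
        rw [RingHom.id_apply, ← MemLp.toLp_const_smul]
        exact MemLp.toLp_congr _ _ ((hcongr _ _ (Lp.coeFn_smul c φ)).trans
          (hsmul _ _ (Lp.memLp φ))) }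
  have hP₀ : ∀ φ : Lp ℝ ∞ μ, P₀ φ =ᵐ[ν] T φ := fun φ => MemLp.coeFn_toLp (hmem φ (Lp.memLp φ))
  have key : ∀ (φ : Lp ℝ ∞ μ) (C : ℝ), 0 ≤ C → (‖P₀ φ‖ ≤ C ↔ ‖φ‖ ≤ C) := by
    intro φ C hC
    rw [Lp_top_norm_le_iff _ hC, Lp_top_norm_le_iff _ hC, ← hnorm φ (Lp.memLp φ) C hC]
    exact ⟨fun h => by filter_upwards [h, hP₀ φ] with x hx h2; rwa [← h2],
      fun h => by filter_upwards [h, hP₀ φ] with x hx h2; rwa [h2]⟩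
  refine ⟨⟨P₀, fun φ => le_antisymm ((key φ _ (norm_nonneg _)).2 le_rfl)
    ((key φ _ (norm_nonneg _)).1 le_rfl)⟩, fun φ hφ => ?_⟩
  exact (hP₀ (hφ.toLp φ)).trans (hcongr _ _ (MemLp.coeFn_toLp hφ))

end LpTop

/-! ### Stationary measures and the Γ-Poisson boundary -/

section Action

variable {Γ X : Type*} [Group Γ] [MeasurableSpace Γ] [MeasurableSpace X] [MulAction Γ X]
  [MeasurableSMul₂ Γ X]

theorem measurable_smul_prod : Measurable (fun p : Γ × X => p.1 • p.2) :=
  measurable_smul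

theorem actConv_actionKernel (μ : Measure Γ) (ν : Measure X) :
    actConv (actionKernel Γ X) μ ν = (μ.prod ν).map (fun p => p.1 • p.2) :=
  Measure.deterministic_comp_eq_map measurable_smul

/-- The slice {γ} × X alone contributes this much to the convolution. When ρ charges γ, null sets
and L¹ bounds thus pass from ρ * ν to the translate of ν by γ. -/
theorem map_smul_le_actConv (ρ : Measure Γ) [SFinite ρ] (ν : Measure X) [SFinite ν]
    (γ : Γ) : ρ {γ} • ν.map (fun x => γ • x) ≤ actConv (actionKernel Γ X) ρ ν := by
  refine Measure.le_iff.2 fun s hs => ?_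
  rw [actConv_actionKernel, Measure.map_apply measurable_smul_prod hs, Measure.smul_apply,
    Measure.map_apply (measurable_const_smul γ) hs, smul_eq_mul, ← Measure.prod_prod]
  refine measure_mono ?_
  rintro ⟨a, x⟩ ⟨ha, hx⟩
  obtain rfl : a = γ := ha
  exact hx

theorem poissonTransform_actionKernel (ν : Measure X) {φ : X → ℝ} (hφ : StronglyMeasurable φ)
    (γ : Γ) : poissonTransform (actionKernel Γ X) ν φ γ = ∫ x, φ (γ • x) ∂ν := by
  unfold poissonTransform actionKernel
  congr 1 with x
  rw [Kernel.integral_deterministic' measurable_smul_prod hφ]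

theorem ae_smul_of_ae_actConv {ρ : Measure Γ} [SFinite ρ] {ν : Measure X} [SFinite ν]
    (hρ : ∀ γ, ρ {γ} ≠ 0) {p : X → Prop} (hp : ∀ᵐ x ∂actConv (actionKernel Γ X) ρ ν, p x)
    (γ : Γ) : ∀ᵐ x ∂ν, p (γ • x) := by
  have h1 : ∀ᵐ x ∂ν.map (fun x => γ • x), p x := by
    have h2 := (Measure.absolutelyContinuous_of_le (map_smul_le_actConv ρ ν γ)).ae_le hp
    exact (Measure.ae_ennreal_smul_measure_iff (hρ γ)).1 h2
  exact ae_of_ae_map (measurable_const_smul γ).aemeasurable h1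

/-- A bound on the Poisson transform of a bounded function is a bound on the function. -/
theorem IsPoissonBoundary.ae_abs_le
    {ρ μ : Measure Γ} {ν : Measure X}
    (hX : IsPoissonBoundary Measure.count ρ μ (actionKernel Γ X) ν) 
    {u : X → ℝ} (hu : StronglyMeasurable u) {K C : ℝ}
    (hK : ∀ᵐ x ∂actConv (actionKernel Γ X) ρ ν, |u x| ≤ K) (hC : 0 ≤ C)
    (h : ∀ γ : Γ, |∫ x, u (γ • x) ∂ν| ≤ C) :
    ∀ᵐ x ∂actConv (actionKernel Γ X) ρ ν, |u x| ≤ C := by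
  have := hX.prob
  obtain ⟨P, hP, -⟩ := hX.isometry
  have hmem : MemLp u ∞ (actConv (actionKernel Γ X) ρ ν) :=
    memLp_top_of_bound hu.aestronglyMeasurable K hK
  have h1 : ‖P (hmem.toLp u)‖ ≤ C := by
    rw [Lp_top_norm_le_iff _ hC]
    filter_upwards [hP u hmem] with γ hγ
    rw [hγ, poissonTransform_actionKernel ν hu]
    exact h γ
  rw [P.norm_map, Lp_top_norm_le_iff _ hC] at h1
  filter_upwards [h1, hmem.coeFn_toLp] with x hx h2
  rwa [← h2]

variable [Countable Γ]

theorem ae_actConv_iff (μ : Measure Γ) [SFinite μ] (ν : Measure X) [SFinite ν] {p : X → Prop}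
    (hp : MeasurableSet {x | p x}) :
    (∀ᵐ x ∂actConv (actionKernel Γ X) μ ν, p x) ↔
      ∀ γ : Γ, μ {γ} ≠ 0 → ∀ᵐ x ∂ν, p (γ • x) := by
  rw [actConv_actionKernel, ae_map_iff measurable_smul_prod.aemeasurable hp,
    Measure.ae_prod_iff_ae_ae (p := fun q : Γ × X => p (q.1 • q.2)) (measurable_smul_prod hp),
    ae_iff_of_countable]

/-- A measure that is stationary for a measure whose support generates is quasi-invariant. -/
theorem quasiMeasurePreserving_smul_of_stationary (μ : Measure Γ) [SFinite μ] (ν : Measure X)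
    [SFinite ν] (hμ : Subsemigroup.closure {γ : Γ | μ {γ} ≠ 0} = ⊤)
    (hν : actConv (actionKernel Γ X) μ ν = ν) (γ : Γ) :
    Measure.QuasiMeasurePreserving (fun x : X => γ • x) ν ν := by
  have hγ : γ ∈ Subsemigroup.closure {γ : Γ | μ {γ} ≠ 0} := hμ ▸ Subsemigroup.mem_top γ
  induction hγ using Subsemigroup.closure_induction with
  | mem γ hγ =>
    refine ⟨measurable_const_smul γ, Measure.AbsolutelyContinuous.mk fun s hs h => ?_⟩
    rw [Measure.map_apply (measurable_const_smul γ) hs]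
    have h1 : ∀ᵐ x ∂actConv (actionKernel Γ X) μ ν, x ∈ sᶜ := by
      rw [hν]; exact measure_eq_zero_iff_ae_notMem.1 h
    exact measure_eq_zero_iff_ae_notMem.2 ((ae_actConv_iff μ ν hs.compl).1 h1 γ hγ)
  | mul a b _ _ ha hb =>
    have := ha.comp hb
    convert this using 2 with x
    exact mul_smul a b x

section Boundary

variable [MeasurableSingletonClass Γ] {ρ μ : Measure Γ} {ν : Measure X}

/-- Every bounded harmonic function on `Γ` is the Poisson transform of a function with the same
bound. -/
theorem IsPoissonBoundary.exists_transform_eq [SFinite ρ]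
    (hX : IsPoissonBoundary Measure.count ρ μ (actionKernel Γ X) ν) (hρ : ∀ γ, ρ {γ} ≠ 0)
    {h : Γ → ℝ} {C : ℝ} (hC : ∀ γ, |h γ| ≤ C) (hh : ∀ γ, h γ = ∫ γ', h (γ * γ') ∂μ) :
    ∃ u : X → ℝ, Measurable u ∧ (∀ x, |u x| ≤ C) ∧ ∀ γ : Γ, ∫ x, u (γ • x) ∂ν = h γ := by
  have := hX.prob
  have hC0 : 0 ≤ C := (abs_nonneg _).trans (hC 1)
  obtain ⟨P, hP, hrange⟩ := hX.isometry
  have hmem : MemLp h ∞ (Measure.count : Measure Γ) :=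
    memLp_top_of_bound (measurable_of_countable h).aestronglyMeasurable C (ae_of_all _ hC)
  have heq : ∀ γ, hmem.toLp h γ = h γ := Measure.ae_count_iff.1 hmem.coeFn_toLp
  have hin : hmem.toLp h ∈ harmonicLinfty Measure.count μ :=
    ae_of_all _ fun γ => by simp only [heq]; exact hh γ
  rw [← hrange] at hin
  obtain ⟨φ, hφ⟩ := hin
  have hφC : ∀ᵐ x ∂actConv (actionKernel Γ X) ρ ν, |φ x| ≤ C := by
    rw [← Lp_top_norm_le_iff _ hC0, ← P.norm_map, hφ, Lp_top_norm_le_iff _ hC0]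
    exact ae_of_all _ fun γ => by rw [heq]; exact hC γ
  have hφm : Measurable φ := (Lp.stronglyMeasurable φ).measurable
  -- Truncation makes the bound hold everywhere. It changes φ only on a ρ * ν-null set, which is
  -- null for every translate of ν.
  refine ⟨fun x => max (-C) (min C (φ x)), by fun_prop, fun x => ?_, fun γ => ?_⟩
  · rw [abs_le]
    exact ⟨le_max_left _ _, max_le (by linarith) (min_le_left _ _)⟩
  · have h1 := hP φ (Lp.memLp φ)
    rw [Lp.toLp_coeFn, hφ] at h1
    have h2 := Measure.ae_count_iff.1 h1 γ
    rw [heq, poissonTransform_actionKernel ν (Lp.stronglyMeasurable φ)] at h2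
    rw [h2]
    refine integral_congr_ae ?_
    filter_upwards [ae_smul_of_ae_actConv hρ hφC γ] with x hx
    rw [abs_le] at hx
    rw [min_eq_right hx.2, max_eq_right hx.1]

/-- On the functions bounded by C the transform is an injective Borel map between standard Borel
spaces, so it has a Borel left inverse (Lusin–Souslin). Applying it to h a selects the preimage
measurably in a. -/
theorem IsPoissonBoundary.exists_measurable_transform_eq [IsProbabilityMeasure ρ]
    [MeasurableSpace.CountablyGenerated X]
    (hX : IsPoissonBoundary Measure.count ρ μ (actionKernel Γ X) ν) (hρ : ∀ γ, ρ {γ} ≠ 0)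
    {α : Type*} [MeasurableSpace α] {h : α → Γ → ℝ} (hm : ∀ γ, Measurable fun a => h a γ)
    {C : ℝ} (hC0 : 0 ≤ C) :
    ∃ F : α × X → ℝ, Measurable F ∧ (∀ p, |F p| ≤ C) ∧ ∀ a, (∀ γ, |h a γ| ≤ C) →
      (∀ γ, h a γ = ∫ γ', h a (γ * γ') ∂μ) → ∀ γ : Γ, ∫ x, F (a, γ • x) ∂ν = h a γ := by
  have := hX.prob
  set m := actConv (actionKernel Γ X) ρ ν with hmdef
  have hmp : IsProbabilityMeasure m := by
    rw [hmdef, actConv_actionKernel]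
    exact Measure.isProbabilityMeasure_map measurable_smul_prod.aemeasurable
  have : Fact ((1 : ℝ≥0∞) ≠ ∞) := ⟨by simp⟩
  let E := Lp ℝ 1 m
  let _ : MeasurableSpace E := borel E
  have : BorelSpace E := ⟨rfl⟩
  have hconst : ∀ c : ℝ, MemLp (fun _ : X => c) 1 m := fun c => memLp_const c
  -- The L^∞ ball is placed inside L¹, which is separable as X is countably generated; as a closed
  -- subset it is standard Borel.
  let B : Set E := Set.Icc ((hconst (-C)).toLp _) ((hconst C).toLp _)
  have hB : ∀ u : E, u ∈ B ↔ ∀ᵐ x ∂m, |u x| ≤ C := by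
    intro u
    rw [Set.mem_Icc, ← Lp.coeFn_le, ← Lp.coeFn_le]
    constructor
    · rintro ⟨h1, h2⟩
      filter_upwards [h1, h2, (hconst C).coeFn_toLp, (hconst (-C)).coeFn_toLp] with x h1 h2 h3 h4
      exact abs_le.2 ⟨by rwa [h4] at h1, by rwa [h3] at h2⟩
    · intro h1
      constructor
      · filter_upwards [h1, (hconst (-C)).coeFn_toLp] with x h1 h4
        rw [h4]; exact (abs_le.1 h1).1
      · filter_upwards [h1, (hconst C).coeFn_toLp] with x h1 h4
        rw [h4]; exact (abs_le.1 h1).2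
  have hBm : MeasurableSet B := isClosed_Icc.measurableSet
  have : StandardBorelSpace B := hBm.standardBorel
  have hint : ∀ (u : E) (γ : Γ), Integrable u (ν.map fun x => γ • x) := by
    intro u γ
    have h1 : Integrable u (ρ {γ} • ν.map fun x => γ • x) :=
      (L1.integrable_coeFn u).mono_measure (map_smul_le_actConv ρ ν γ)
    exact (integrable_smul_measure (hρ γ) (measure_ne_top _ _)).1 h1
  let S : B → Γ → ℝ := fun u γ => ∫ x, (u : E) x ∂(ν.map fun x => γ • x)
  have hcont : ∀ γ : Γ, Continuous fun u : E => ∫ x, u x ∂(ν.map fun x => γ • x) := by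
    intro γ
    rw [continuous_iff_continuousAt]
    intro u
    refine tendsto_integral_of_L1 u (hint u γ).1 (Filter.Eventually.of_forall fun v => hint v γ) ?_
    have hlim : Filter.Tendsto (fun v : E => (ρ {γ})⁻¹ * edist v u) (nhds u) (nhds 0) := by
      have : Filter.Tendsto (fun v : E => edist v u) (nhds u) (nhds (edist u u)) :=
        (continuous_id.edist continuous_const).tendsto u
      rw [edist_self] at this
      simpa using ENNReal.Tendsto.const_mul this (Or.inr (ENNReal.inv_ne_top.2 (hρ γ)))
    refine tendsto_of_tendsto_of_tendsto_of_le_of_le tendsto_const_nhds hlim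
      (fun v => zero_le) (fun v => ?_)
    have h1 : edist v u = ∫⁻ x, ‖v x - u x‖ₑ ∂m := by
      rw [Lp.edist_def, eLpNorm_one_eq_lintegral_enorm]
      rfl
    have h2 : ρ {γ} * ∫⁻ x, ‖v x - u x‖ₑ ∂(ν.map fun x => γ • x) ≤ ∫⁻ x, ‖v x - u x‖ₑ ∂m := by
      rw [← smul_eq_mul, ← lintegral_smul_measure]
      exact lintegral_mono' (map_smul_le_actConv ρ ν γ) le_rfl
    rw [h1, ← ENNReal.div_eq_inv_mul, ENNReal.le_div_iff_mul_le (Or.inl (hρ γ))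
      (Or.inl (measure_ne_top _ _)), mul_comm]
    exact h2
  have hSm : Measurable S := measurable_pi_iff.2 fun γ =>
    (hcont γ).measurable.comp measurable_subtype_coe
  have hSeq : ∀ (u : B) (γ : Γ), S u γ = ∫ x, (u : E) (γ • x) ∂ν := fun u γ =>
    integral_map (measurable_const_smul γ).aemeasurable
      (Lp.stronglyMeasurable (u : E)).aestronglyMeasurable
  have hint' : ∀ (u : E) (γ : Γ), Integrable (fun x => u (γ • x)) ν := fun u γ =>
    (hint u γ).comp_measurable (measurable_const_smul γ)
  have hSinj : Function.Injective S := by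
    intro u v huv
    have h0 : ∀ᵐ x ∂m, |(u : E) x - (v : E) x| ≤ 0 := by
      refine hX.ae_abs_le (u := fun x => (u : E) x - (v : E) x)
        ((Lp.stronglyMeasurable (u : E)).sub (Lp.stronglyMeasurable (v : E)))
        (K := C + C) ?_ le_rfl fun γ => ?_
      · filter_upwards [(hB u).1 u.2, (hB v).1 v.2] with x h1 h2
        exact (abs_sub _ _).trans (add_le_add h1 h2)
      · have := congrFun huv γ
        rw [hSeq, hSeq] at this
        rw [integral_sub (hint' _ _) (hint' _ _), this, sub_self, abs_zero]
    refine Subtype.ext (Lp.ext ?_)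
    filter_upwards [h0] with x hx
    exact sub_eq_zero.1 (abs_nonpos_iff.1 hx)
  have hne : Nonempty B := ⟨⟨0, (hB 0).2 (by
    filter_upwards [Lp.coeFn_zero ℝ 1 m] with x hx
    rw [hx]; simpa using hC0)⟩⟩
  -- R ∘ S is the identity; only values on the range of S matter.
  obtain ⟨R, hRm, hR⟩ := (hSm.measurableEmbedding hSinj).exists_measurable_extend
    (measurable_id (α := B)) fun _ => hne
  have hRh : Measurable fun a => R (h a) := hRm.comp (measurable_pi_iff.2 hm)
  have hpos : ∀ u : B, ∀ᵐ x ∂m, 0 ≤ (u : E) x + C ∧ (u : E) x + C ≤ 2 * C := by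
    intro u
    filter_upwards [(hB u).1 u.2] with x hx
    constructor <;> linarith [(abs_le.1 hx).1, (abs_le.1 hx).2]
  have hdm : ∀ u : B, Measurable fun x => ENNReal.ofReal ((u : E) x + C) := fun u =>
    ENNReal.measurable_ofReal.comp ((Lp.stronglyMeasurable (u : E)).measurable.add_const C)
  have hKm : Measurable fun u : B => m.withDensity fun x => ENNReal.ofReal ((u : E) x + C) := by
    refine Measure.measurable_of_measurable_coe _ fun s hs => ?_
    have : (fun u : B => (m.withDensity fun x => ENNReal.ofReal ((u : E) x + C)) s) =
        fun u : B => ENNReal.ofReal ((∫ x in s, (u : E) x ∂m) + ∫ x in s, C ∂m) := by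
      ext u
      rw [withDensity_apply _ hs, ← integral_add (L1.integrable_coeFn (u : E)).integrableOn
        (integrable_const C), ofReal_integral_eq_lintegral_ofReal
        (f := fun x => (u : E) x + C) ((L1.integrable_coeFn (u : E)).integrableOn.add (integrable_const C))]
      exact ae_restrict_of_ae ((hpos u).mono fun x hx => hx.1)
    rw [this]
    exact ENNReal.measurable_ofReal.comp
      (((continuous_setIntegral s).measurable.comp measurable_subtype_coe).add_const _)
  -- Representatives of the classes R (h a) need not be jointly measurable in (a, x). They are
  -- encoded as densities of a kernel, shifted by C to be nonnegative, and recovered from the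
  -- jointly measurable Radon–Nikodym derivative.
  let K : Kernel α X := ⟨fun a => m.withDensity fun x => ENNReal.ofReal ((R (h a) : E) x + C),
    hKm.comp hRh⟩
  have hKfin : IsFiniteKernel K := by
    refine ⟨⟨ENNReal.ofReal (2 * C), ENNReal.ofReal_lt_top, fun a => ?_⟩⟩
    change (m.withDensity fun x => ENNReal.ofReal ((R (h a) : E) x + C)) Set.univ ≤ _
    rw [withDensity_apply _ MeasurableSet.univ, Measure.restrict_univ]
    refine (lintegral_mono_ae ((hpos (R (h a))).mono fun x hx =>
      ENNReal.ofReal_le_ofReal hx.2)).trans ?_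
    simp
  let D : α × X → ℝ := fun p => (K.rnDeriv (Kernel.const α m) p.1 p.2).toReal - C
  have hD : Measurable D := (Kernel.measurable_rnDeriv K (Kernel.const α m)).ennreal_toReal.sub_const C
  refine ⟨fun p => max (-C) (min C (D p)), by fun_prop, fun p => ?_, fun a hb hh γ => ?_⟩
  · rw [abs_le]
    exact ⟨le_max_left _ _, max_le (by linarith) (min_le_left _ _)⟩
  · obtain ⟨u, hum, huC, hu⟩ := hX.exists_transform_eq hρ hb hh
    have humem : MemLp u 1 m := MemLp.of_bound hum.aestronglyMeasurable C (ae_of_all _ huC)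
    have hv : humem.toLp u ∈ B := (hB _).2 (by
      filter_upwards [humem.coeFn_toLp] with x hx
      rw [hx]; exact huC x)
    have hSv : S ⟨_, hv⟩ = h a := by
      ext γ'
      rw [hSeq, ← hu γ']
      exact integral_congr_ae (ae_smul_of_ae_actConv hρ humem.coeFn_toLp γ')
    have hSR : S (R (h a)) = h a := by
      have : R (S ⟨_, hv⟩) = ⟨_, hv⟩ := congrFun hR _
      rw [← hSv, this]
    have hDu : ∀ᵐ x ∂m, max (-C) (min C (D (a, x))) = (R (h a) : E) x := by
      have h1 : K.rnDeriv (Kernel.const α m) a =ᵐ[m] (K a).rnDeriv m :=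
        Kernel.rnDeriv_eq_rnDeriv_measure
      have h2 : (K a).rnDeriv m =ᵐ[m] fun x => ENNReal.ofReal ((R (h a) : E) x + C) :=
        Measure.rnDeriv_withDensity m (hdm _)
      filter_upwards [h1, h2, (hB (R (h a))).1 (R (h a)).2] with x hx1 hx2 hx3
      rw [abs_le] at hx3
      have : D (a, x) = (R (h a) : E) x := by
        simp only [D]
        rw [hx1, hx2, ENNReal.toReal_ofReal (by linarith), add_sub_cancel_right]
      rw [this, min_eq_right hx3.2, max_eq_right hx3.1]
    rw [← congrFun hSR γ, hSeq]
    exact integral_congr_ae (ae_smul_of_ae_actConv hρ hDu γ)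

end Boundary
end Action

/-! ### Orbits, fundamental domains and the orbit kernel -/

theorem zeroExt_coe {G X : Type*} {Δ : Set (G × X)} (φ : Δ → ℝ) (y : Δ) : zeroExt φ y = φ y :=
  Subtype.val_injective.extend_apply φ (0 : G × X → ℝ) y

theorem zeroExt_of_notMem {G X : Type*} {Δ : Set (G × X)} (φ : Δ → ℝ) {p : G × X} (hp : p ∉ Δ) :
    zeroExt φ p = 0 :=
  Function.extend_apply' φ (0 : G × X → ℝ) p fun ⟨y, hy⟩ => hp (hy ▸ y.2)

theorem ae_onDomain_iff {G X : Type*} [MeasurableSpace G] [MeasurableSpace X]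
    {m : Measure (G × X)} {Δ : Set (G × X)} (hΔ : MeasurableSet Δ)
    {q : Δ → Prop} : (∀ᵐ y ∂onDomain m Δ, q y) ↔ ∀ᵐ p ∂m, ∀ h : p ∈ Δ, q ⟨p, h⟩ := by
  have h1 : (∀ᵐ y ∂onDomain m Δ, q y) ↔
      ∀ᵐ y : Δ ∂onDomain m Δ, ∀ h : (y : G × X) ∈ Δ, q ⟨y, h⟩ :=
    Filter.eventually_congr (ae_of_all _ fun y => ⟨fun hq _ => hq, fun hq => hq y.2⟩)
  rw [h1]
  unfold onDomain
  rw [← ae_restrict_iff_subtype hΔ (p := fun p => ∀ h : p ∈ Δ, q ⟨p, h⟩), ae_restrict_iff' hΔ]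
  exact ⟨fun h => h.mono fun p hp hpΔ => hp hpΔ hpΔ, fun h => h.mono fun p hp _ => hp⟩

section StarAction

variable {G X : Type*} [Group G] {Γ : Subgroup G} [MulAction Γ X]

@[simp]
theorem starAct_one (p : G × X) : starAct (1 : Γ) p = p := by
  simp [starAct]

theorem starAct_mul (a b : Γ) (p : G × X) : starAct (a * b) p = starAct a (starAct b p) := by
  simp [starAct, mul_smul, mul_assoc]

theorem mem_image_starAct {γ : Γ} {A : Set (G × X)} {p : G × X} :
    p ∈ starAct γ '' A ↔ starAct γ⁻¹ p ∈ A := by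
  constructor
  · rintro ⟨q, hq, rfl⟩
    rwa [← starAct_mul, inv_mul_cancel, starAct_one]
  · intro h
    exact ⟨_, h, by rw [← starAct_mul, mul_inv_cancel, starAct_one]⟩

theorem starAct_mul_left (γ : Γ) (g : G) (p : G × X) :
    starAct γ (g * p.1, p.2) = (g * (starAct γ p).1, (starAct γ p).2) := by
  simp [starAct, mul_assoc]

/-- `y` is the only point of `Δ` on the `⋆`-orbit of `p`, and is reached once. -/
def IsOrbitPoint (Δ : Set (G × X)) (p : G × X) (y : Δ) : Prop :=
  ∃ γ : Γ, starAct γ p = y ∧ ∀ γ' : Γ, starAct γ' p ∈ Δ → γ' = γ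

theorem exists_isOrbitPoint_iff {Δ : Set (G × X)} {p : G × X} :
    (∃ y : Δ, IsOrbitPoint (Γ := Γ) Δ p y) ↔ ∃! γ : Γ, starAct γ p ∈ Δ := by
  constructor
  · rintro ⟨y, γ, h, h'⟩
    exact ⟨γ, by simp only [h]; exact y.2, h'⟩
  · rintro ⟨γ, h, h'⟩
    exact ⟨⟨_, h⟩, γ, rfl, h'⟩

theorem IsOrbitPoint.eq_self {Δ : Set (G × X)} {y z : Δ}
    (h : IsOrbitPoint (Γ := Γ) Δ (y : G × X) z) : z = y := by
  obtain ⟨γ₀, h1, h2⟩ := h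
  have : (1 : Γ) = γ₀ := h2 1 (by rw [starAct_one]; exact y.2)
  subst this
  rw [starAct_one] at h1
  exact Subtype.ext h1.symm

/-- The sum of `φ 1_Δ` over the `⋆`-orbit of `p`. -/
noncomputable def orbitSum (Γ : Subgroup G) [MulAction Γ X] {Δ : Set (G × X)} (φ : Δ → ℝ) (p : G × X) : ℝ :=
  ∑' γ : Γ, zeroExt φ (starAct γ p)

theorem IsOrbitPoint.orbitSum_eq {Δ : Set (G × X)} {p : G × X} {y : Δ}
    (h : IsOrbitPoint (Γ := Γ) Δ p y) (φ : Δ → ℝ) : orbitSum Γ φ p = φ y := by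
  obtain ⟨γ₀, h1, h2⟩ := h
  unfold orbitSum
  rw [tsum_eq_single γ₀ fun γ hγ => zeroExt_of_notMem φ fun h => hγ (h2 γ h), h1, zeroExt_coe]

variable [MeasurableSpace G] [MeasurableSpace X]

section FundamentalDomain

variable [Countable Γ]

/-- The `⋆`-orbit of almost every point meets a fundamental domain exactly once. -/
theorem IsStarFundamentalDomain.ae_exists_isOrbitPoint {m : Measure (G × X)} {Δ : Set (G × X)}
    (hΔ : IsStarFundamentalDomain Γ m Δ)
    (hq : ∀ γ : Γ, Measure.QuasiMeasurePreserving (starAct γ) m m)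
    {Q : Δ → Prop} (hQ : ∀ᵐ y ∂onDomain m Δ, Q y) :
    ∀ᵐ p ∂m, ∃ y : Δ, Q y ∧ IsOrbitPoint (Γ := Γ) Δ p y := by
  have h1 : ∀ᵐ p ∂m, p ∈ ⋃ γ : Γ, starAct γ '' Δ := by
    have := measure_eq_zero_iff_ae_notMem.1 hΔ.covers
    filter_upwards [this] with p hp
    by_contra h
    exact hp ⟨trivial, h⟩
  have h2 : ∀ᵐ p ∂m, ∀ γ : Γ, starAct γ p ∉ Δ ∩ ⋃ γ : Γ, ⋃ _ : γ ≠ 1, starAct γ '' Δ :=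
    ae_all_iff.2 fun γ => (hq γ).ae (measure_eq_zero_iff_ae_notMem.1 hΔ.disjoint)
  have h3 : ∀ᵐ p ∂m, ∀ (γ : Γ) (h : starAct γ p ∈ Δ), Q ⟨_, h⟩ :=
    ae_all_iff.2 fun γ => (hq γ).ae ((ae_onDomain_iff hΔ.measurableSet).1 hQ)
  filter_upwards [h1, h2, h3] with p hp1 hp2 hp3
  obtain ⟨γ, hγ⟩ := Set.mem_iUnion.1 hp1
  rw [mem_image_starAct] at hγ
  refine ⟨⟨_, hγ⟩, hp3 _ hγ, γ⁻¹, rfl, fun γ' hγ' => ?_⟩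
  by_contra hne
  -- If γ' also carries p into Δ, then γ⁻¹ ⋆ p is the image of γ' ⋆ p under γ⁻¹γ'⁻¹ ≠ 1, so it lies
  -- in the excluded overlap.
  refine hp2 γ⁻¹ ⟨hγ, Set.mem_iUnion₂.2 ⟨γ⁻¹ * γ'⁻¹, fun h => hne ?_, ?_⟩⟩
  · rw [mul_inv_eq_one] at h; exact h.symm
  · rwa [mem_image_starAct, ← starAct_mul, mul_inv_rev, inv_inv, inv_inv, mul_inv_cancel_right]

/-- An almost everywhere property of points of `Δ` can be tested on `G × X`. -/
theorem IsStarFundamentalDomain.ae_onDomain_iff_ae {m : Measure (G × X)} {Δ : Set (G × X)}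
    (hΔ : IsStarFundamentalDomain Γ m Δ)
    (hq : ∀ γ : Γ, Measure.QuasiMeasurePreserving (starAct γ) m m)
    {Q : Δ → Prop} :
    (∀ᵐ y ∂onDomain m Δ, Q y) ↔ ∀ᵐ p ∂m, ∃ y : Δ, Q y ∧ IsOrbitPoint (Γ := Γ) Δ p y := by
  refine ⟨fun h => hΔ.ae_exists_isOrbitPoint hq h, fun h => ?_⟩
  rw [ae_onDomain_iff hΔ.measurableSet]
  filter_upwards [h] with p hp hpΔ
  obtain ⟨y, hy, hpy⟩ := hp
  rwa [hpy.eq_self (y := ⟨p, hpΔ⟩)] at hy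

end FundamentalDomain

variable [MeasurableMul₂ G] [MeasurableSMul₂ Γ X]

theorem measurable_starAct (γ : Γ) : Measurable (starAct γ : G × X → G × X) :=
  (measurable_fst.mul_const _).prodMk (measurable_snd.const_smul γ)

variable [Countable Γ]

/-- The sum of the point masses at the points of `Δ` on the `⋆`-orbit of `p`. -/
noncomputable def orbitKernel (Γ : Subgroup G) [Countable Γ] [MulAction Γ X] [MeasurableSMul₂ Γ X]
    {Δ : Set (G × X)} (hΔ : MeasurableSet Δ) : Kernel (G × X) Δ :=
  Kernel.comapRight
    (Kernel.sum fun γ : Γ => Kernel.deterministic (starAct γ) (measurable_starAct γ))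
    (MeasurableEmbedding.subtype_coe hΔ)

instance {Δ : Set (G × X)} (hΔ : MeasurableSet Δ) : IsSFiniteKernel (orbitKernel Γ hΔ) := by
  unfold orbitKernel
  infer_instance

instance {Δ : Set (G × X)} (hΔ : MeasurableSet Δ) : IsSFiniteKernel (inducedKernel Γ hΔ) := by
  unfold inducedKernel
  infer_instance

theorem orbitKernel_apply {Δ : Set (G × X)} (hΔ : MeasurableSet Δ) (p : G × X) {A : Set Δ}
    (hA : MeasurableSet A) :
    orbitKernel Γ hΔ p A = ∑' γ : Γ, (Subtype.val '' A).indicator 1 (starAct γ p) := by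
  have hA' := (MeasurableEmbedding.subtype_coe hΔ).measurableSet_image.2 hA
  unfold orbitKernel
  rw [Kernel.comapRight_apply' _ _ _ hA, Kernel.sum_apply' _ _ hA']
  exact tsum_congr fun γ => Kernel.deterministic_apply' _ _ hA'

theorem inducedKernel_apply {Δ : Set (G × X)} (hΔ : MeasurableSet Δ) (g : G) (y : Δ) :
    inducedKernel Γ hΔ (g, y) = orbitKernel Γ hΔ (g * y.1.1, y.1.2) := by
  ext A hA
  have hA' := (MeasurableEmbedding.subtype_coe hΔ).measurableSet_image.2 hA
  rw [orbitKernel_apply _ _ hA]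
  unfold inducedKernel
  rw [Kernel.comapRight_apply' _ _ _ hA, Kernel.sum_apply' _ _ hA']
  exact tsum_congr fun γ => Kernel.deterministic_apply' _ _ hA'

/-- The sum over Γ is reindexed by right multiplication. No exceptional set appears, so integrals
against the kernel are invariant everywhere. -/
theorem orbitKernel_starAct {Δ : Set (G × X)} (hΔ : MeasurableSet Δ) (γ : Γ) (p : G × X) :
    orbitKernel Γ hΔ (starAct γ p) = orbitKernel Γ hΔ p := by
  ext A hA
  rw [orbitKernel_apply _ _ hA, orbitKernel_apply _ _ hA,
    ← (Equiv.mulRight γ).tsum_eq fun γ' => (Subtype.val '' A).indicator 1 (starAct γ' p)]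
  exact tsum_congr fun γ' => by rw [Equiv.coe_mulRight, starAct_mul]

theorem IsOrbitPoint.orbitKernel_eq {Δ : Set (G × X)} (hΔ : MeasurableSet Δ) {p : G × X} {y : Δ}
    (h : IsOrbitPoint (Γ := Γ) Δ p y) : orbitKernel Γ hΔ p = Measure.dirac y := by
  ext A hA
  obtain ⟨γ₀, h1, h2⟩ := h
  rw [orbitKernel_apply _ _ hA, Measure.dirac_apply' _ hA, tsum_eq_single γ₀, h1]
  · by_cases hy : y ∈ A
    · rw [Set.indicator_of_mem hy, Set.indicator_of_mem (Set.mem_image_of_mem _ hy)]; rfl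
    · rw [Set.indicator_of_notMem hy, Set.indicator_of_notMem]
      rintro ⟨z, hz, hzy⟩
      exact hy (Subtype.ext hzy ▸ hz)
  · intro γ hγ
    refine Set.indicator_of_notMem ?_ _
    rintro ⟨z, -, hz⟩
    exact hγ (h2 γ (hz ▸ z.2))

/-- The point of the orbit of `(g₀ g, x)` is the translate by `g₀` of the point of `(g, x)`. -/
theorem IsOrbitPoint.inducedKernel_eq {Δ : Set (G × X)} (hΔ : MeasurableSet Δ) {p : G × X}
    {y : Δ} (h : IsOrbitPoint (Γ := Γ) Δ p y) (g : G) :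
    inducedKernel Γ hΔ (g, y) = orbitKernel Γ hΔ (g * p.1, p.2) := by
  obtain ⟨γ₀, h1, h2⟩ := h
  rw [inducedKernel_apply, ← h1, ← starAct_mul_left, orbitKernel_starAct]

/-- By Tonelli, the sum over γ moves inside the integral. In this form the invariance of the orbit
kernel applies to ν̃. -/
theorem nuTilde_eq_bind (ν : Measure X) {Δ : Set (G × X)} (hΔ : MeasurableSet Δ) :
    nuTilde Γ ν Δ = ν.bind fun x => orbitKernel Γ hΔ ((1 : G), x) := by
  ext A hA
  have hA' := (MeasurableEmbedding.subtype_coe hΔ).measurableSet_image.2 hA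
  have hm : ∀ γ : Γ, Measurable fun x : X => starAct γ ((1 : G), x) := fun γ =>
    (measurable_starAct γ).comp measurable_prodMk_left
  have hK : Measurable fun x : X => orbitKernel Γ hΔ ((1 : G), x) :=
    (orbitKernel Γ hΔ).measurable.comp measurable_prodMk_left
  rw [Measure.bind_apply hA hK.aemeasurable]
  unfold nuTilde onDomain
  rw [(MeasurableEmbedding.subtype_coe hΔ).comap_apply, Measure.sum_apply _ hA']
  simp_rw [orbitKernel_apply hΔ _ hA]
  rw [lintegral_tsum (f := fun (γ : Γ) x => (Subtype.val '' A).indicator 1 (starAct γ ((1 : G), x)))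
    fun γ => ((measurable_one.indicator hA').comp (hm γ)).aemeasurable]
  refine tsum_congr fun γ => ?_
  rw [Measure.map_apply (hm γ) hA', ← lintegral_indicator_one (hm γ hA')]
  rfl

end StarAction

/-! ### Invariant functions and their restrictions to Δ -/

section InvariantFunctions

variable {G X : Type*} [Group G] {Γ : Subgroup G} [MulAction Γ X]
  [MeasurableSpace G] [MeasurableSpace X] {m : Measure (G × X)} {Δ : Set (G × X)}

theorem IsStarFundamentalDomain.memLp_restrict (hΔ : IsStarFundamentalDomain Γ m Δ)
    {F : G × X → ℝ} (hF : Measurable F) {C : ℝ} (hC : ∀ᵐ p ∂m, |F p| ≤ C) :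
    MemLp (fun y : Δ => F y) ∞ (onDomain m Δ) :=
  memLp_top_of_bound (hF.comp measurable_subtype_coe).aestronglyMeasurable C
    ((ae_onDomain_iff hΔ.measurableSet).2 (hC.mono fun _ hp _ => hp))

theorem invariantSigma_le : invariantSigma Γ m ≤ (inferInstance : MeasurableSpace (G × X)) :=
  fun _ hA => hA.1

theorem ae_invariant_of_measurable {F : G × X → ℝ} (hF : Measurable[invariantSigma Γ m] F) :
    ∀ᵐ p ∂m, ∀ γ : Γ, F (starAct γ p) = F p := by
  -- Only rational levels are used, so that countably many null sets are discarded.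
  have h : ∀ᵐ p ∂m, ∀ r : ℚ, ∀ γ : Γ, (starAct γ p ∈ F ⁻¹' Set.Iio (r : ℝ) ↔
      p ∈ F ⁻¹' Set.Iio (r : ℝ)) :=
    ae_all_iff.2 fun r => (hF measurableSet_Iio).2
  filter_upwards [h] with p hp γ
  have hp' : ∀ r : ℚ, F (starAct γ p) < r ↔ F p < r := fun r => hp r γ
  refine le_antisymm (le_of_forall_lt_rat_imp_le fun r hr => ?_)
    (le_of_forall_lt_rat_imp_le fun r hr => ?_)
  · exact ((hp' r).2 hr).le
  · exact ((hp' r).1 hr).le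

/-- An invariant function is determined by its restriction to `Δ`. -/
theorem IsStarFundamentalDomain.ae_restrict_eq [Countable Γ]
    (hΔ : IsStarFundamentalDomain Γ m Δ)
    (hq : ∀ γ : Γ, Measure.QuasiMeasurePreserving (starAct γ) m m)
    {F : G × X → ℝ} (hinv : ∀ᵐ p ∂m, ∀ γ : Γ, F (starAct γ p) = F p) :
    ∀ᵐ p ∂m, ∃ y : Δ, F p = F y ∧ IsOrbitPoint (Γ := Γ) Δ p y := by
  filter_upwards [hinv, hΔ.ae_exists_isOrbitPoint hq (Q := fun _ => True)
    (ae_of_all _ fun _ => trivial)] with p hp ⟨y, _, hy⟩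
  refine ⟨y, ?_, hy⟩
  obtain ⟨γ, h1, -⟩ := hy
  rw [← h1, hp γ]

end InvariantFunctions

/-! ### The induced action and the isometry with invariant functions -/

section InducedAction

variable {G X : Type*} [Group G] {Γ : Subgroup G} [Countable Γ] [MulAction Γ X]
  [MeasurableSpace G] [MeasurableSpace X] [MeasurableMul₂ G] [MeasurableSMul₂ Γ X]
  {m : Measure (G × X)} {Δ : Set (G × X)}

theorem IsStarFundamentalDomain.isNearAction_inducedKernel (hΔ : IsStarFundamentalDomain Γ m Δ)
    (hq : ∀ γ : Γ, Measure.QuasiMeasurePreserving (starAct γ) m m)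
    (hl : ∀ g : G, Measure.QuasiMeasurePreserving (fun p : G × X => (g * p.1, p.2)) m m) :
    IsNearAction (inducedKernel Γ hΔ.measurableSet) (onDomain m Δ) := by
  have hdom : ∀ {R : G × X → Prop}, (∀ᵐ p ∂m, R p) → ∀ᵐ y : Δ ∂onDomain m Δ, R y := fun h =>
    (ae_onDomain_iff hΔ.measurableSet).2 (h.mono fun p hp _ => hp)
  have horb : ∀ᵐ p ∂m, ∃ y : Δ, IsOrbitPoint (Γ := Γ) Δ p y := by
    have := hΔ.ae_exists_isOrbitPoint hq (Q := fun _ => True) (ae_of_all _ fun _ => trivial)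
    simpa using this
  refine ⟨fun g => ?_, fun g A hA h0 => ?_, ?_, fun g h => ?_⟩
  · filter_upwards [hdom ((hl g).ae horb)] with y ⟨z, hz⟩
    exact ⟨z, by rw [inducedKernel_apply, hz.orbitKernel_eq]⟩
  · have h1 := hΔ.ae_exists_isOrbitPoint hq (measure_eq_zero_iff_ae_notMem.1 h0)
    filter_upwards [hdom ((hl g).ae h1)] with y ⟨z, hzA, hz⟩
    rw [inducedKernel_apply, hz.orbitKernel_eq, Measure.dirac_apply' _ hA,
      Set.indicator_of_notMem hzA]
  · filter_upwards [hdom horb] with y ⟨z, hz⟩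
    rw [inducedKernel_apply, one_mul, Prod.mk.eta, hz.orbitKernel_eq, hz.eq_self]
  · filter_upwards [hdom ((hl h).ae horb)] with y ⟨z, hz⟩
    rw [inducedKernel_apply _ h, hz.orbitKernel_eq, Measure.dirac_bind
      (f := fun z => inducedKernel Γ hΔ.measurableSet (g, z))
      ((inducedKernel Γ hΔ.measurableSet).measurable.comp measurable_prodMk_left),
      hz.inducedKernel_eq, inducedKernel_apply, mul_assoc]

theorem IsStarFundamentalDomain.ae_integral_inducedKernel [MeasurableSingletonClass G]
    [MeasurableSingletonClass X] (hΔ : IsStarFundamentalDomain Γ m Δ)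
    (hq : ∀ γ : Γ, Measure.QuasiMeasurePreserving (starAct γ) m m)
    (hl : ∀ g : G, Measure.QuasiMeasurePreserving (fun p : G × X => (g * p.1, p.2)) m m)
    (φ : Δ → ℝ) (g : G) : ∀ᵐ y ∂onDomain m Δ,
      ∫ z, φ z ∂inducedKernel Γ hΔ.measurableSet (g, y) = orbitSum Γ φ (g * y.1.1, y.1.2) := by
  have horb := hΔ.ae_exists_isOrbitPoint hq (Q := fun _ => True) (ae_of_all _ fun _ => trivial)
  rw [ae_onDomain_iff hΔ.measurableSet]
  filter_upwards [(hl g).ae horb] with p ⟨y, _, hy⟩ hp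
  rw [inducedKernel_apply, hy.orbitKernel_eq, hy.orbitSum_eq, integral_dirac]

/-- A bounded function on `Δ` extends to a bounded `⋆`-invariant function. -/
theorem IsStarFundamentalDomain.exists_invariant_lift (hΔ : IsStarFundamentalDomain Γ m Δ)
    (hq : ∀ γ : Γ, Measure.QuasiMeasurePreserving (starAct γ) m m)
    {φ : Δ → ℝ} (hφ : MemLp φ ∞ (onDomain m Δ)) :
    ∃ F : G × X → ℝ, Measurable F ∧ (∀ (γ : Γ) p, F (starAct γ p) = F p) ∧
      (∃ C, ∀ p, |F p| ≤ C) ∧ ∀ᵐ p ∂m, ∃ y : Δ, F p = φ y ∧ IsOrbitPoint (Γ := Γ) Δ p y := by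
  set C : ℝ := ‖hφ.toLp φ‖
  have hC : ∀ᵐ y ∂onDomain m Δ, |φ y| ≤ C := by
    filter_upwards [(Lp_top_norm_le_iff (hφ.toLp φ) (norm_nonneg _)).1 le_rfl, hφ.coeFn_toLp]
      with y h1 h2
    rwa [h2] at h1
  have hψ := hφ.1.stronglyMeasurable_mk
  set ψ := hφ.1.mk φ
  have hφψ : φ =ᵐ[onDomain m Δ] ψ := hφ.1.ae_eq_mk
  have hI : Measurable fun p => ∫ y, ψ y ∂orbitKernel Γ hΔ.measurableSet p :=
    (hψ.integral_kernel (κ := orbitKernel Γ hΔ.measurableSet)).measurable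
  -- Where the orbit misses Δ or meets it several times the integral has no useful value; truncation
  -- keeps it bounded there without spoiling invariance.
  refine ⟨fun p => max (-C) (min C (∫ y, ψ y ∂orbitKernel Γ hΔ.measurableSet p)), by fun_prop,
    fun γ p => by simp only [orbitKernel_starAct], ⟨C, fun p => ?_⟩, ?_⟩
  · rw [abs_le]
    exact ⟨le_max_left _ _, max_le ((neg_nonpos.2 (norm_nonneg _)).trans (norm_nonneg _))
      (min_le_left _ _)⟩
  · filter_upwards [hΔ.ae_exists_isOrbitPoint hq (hC.and hφψ)] with p ⟨y, ⟨hy1, hy2⟩, hpy⟩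
    refine ⟨y, ?_, hpy⟩
    rw [hpy.orbitKernel_eq, integral_dirac' _ _ hψ, ← hy2, min_eq_right (abs_le.1 hy1).2,
      max_eq_right (abs_le.1 hy1).1]

/-- Summation over orbits identifies `L^∞(Δ)` with the invariant functions. -/
theorem IsStarFundamentalDomain.exists_linearIsometryEquiv (hΔ : IsStarFundamentalDomain Γ m Δ)
    (hq : ∀ γ : Γ, Measure.QuasiMeasurePreserving (starAct γ) m m) :
    ∃ e : Lp ℝ ∞ (onDomain m Δ) ≃ₗᵢ[ℝ] lpMeas ℝ ℝ (invariantSigma Γ m) ∞ m,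
      ∀ φ : Lp ℝ ∞ (onDomain m Δ),
        ((e φ : Lp ℝ ∞ m) : G × X → ℝ) =ᵐ[m] fun p => ∑' γ : Γ, zeroExt φ (starAct γ p) := by
  have hlift : ∀ φ : Δ → ℝ, MemLp φ ∞ (onDomain m Δ) → ∃ F : G × X → ℝ, Measurable F ∧
      (∀ (γ : Γ) p, F (starAct γ p) = F p) ∧ (∃ C, ∀ p, |F p| ≤ C) ∧ orbitSum Γ φ =ᵐ[m] F := by
    intro φ hφ
    obtain ⟨F, h1, h2, h3, h4⟩ := hΔ.exists_invariant_lift hq hφ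
    refine ⟨F, h1, h2, h3, ?_⟩
    filter_upwards [h4] with p ⟨y, hy, hpy⟩
    rw [hpy.orbitSum_eq, hy]
  have horb := hΔ.ae_exists_isOrbitPoint hq (Q := fun _ => True) (ae_of_all _ fun _ => trivial)
  obtain ⟨P, hP⟩ := exists_linearIsometry_of_ae (μ := onDomain m Δ) (ν := m) (orbitSum Γ)
    (fun φ hφ => by
      obtain ⟨F, h1, -, ⟨C, hC⟩, h2⟩ := hlift φ hφ
      exact (memLp_top_of_bound h1.aestronglyMeasurable C (ae_of_all _ hC)).ae_eq h2.symm)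
    (fun φ ψ h => by
      filter_upwards [hΔ.ae_exists_isOrbitPoint hq h] with p ⟨y, hy, hpy⟩
      rw [hpy.orbitSum_eq, hpy.orbitSum_eq, hy])
    (fun φ ψ _ _ => by
      filter_upwards [horb] with p ⟨y, _, hpy⟩
      simp only [Pi.add_apply, hpy.orbitSum_eq])
    (fun c φ _ => by
      filter_upwards [horb] with p ⟨y, _, hpy⟩
      simp only [Pi.smul_apply, hpy.orbitSum_eq])
    (fun φ _ C _ => by
      rw [hΔ.ae_onDomain_iff_ae hq]
      constructor
      · intro h
        filter_upwards [h, horb] with p hp ⟨y, _, hpy⟩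
        exact ⟨y, by rwa [hpy.orbitSum_eq] at hp, hpy⟩
      · intro h
        filter_upwards [h] with p ⟨y, hy, hpy⟩
        rwa [hpy.orbitSum_eq])
  have hP' : ∀ φ : Lp ℝ ∞ (onDomain m Δ), P φ =ᵐ[m] orbitSum Γ φ := fun φ => by
    simpa using hP φ (Lp.memLp φ)
  have hmem : ∀ φ, P φ ∈ lpMeas ℝ ℝ (invariantSigma Γ m) ∞ m := by
    intro φ
    rw [mem_lpMeas_iff_aestronglyMeasurable]
    obtain ⟨F, h1, h2, -, h4⟩ := hlift φ (Lp.memLp φ)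
    refine ⟨F, Measurable.stronglyMeasurable (mα := invariantSigma Γ m) fun s hs =>
      ⟨h1 hs, ae_of_all _ fun p γ => ?_⟩, (hP' φ).trans h4⟩
    simp only [Set.mem_preimage, h2]
  let e₀ : Lp ℝ ∞ (onDomain m Δ) →ₗᵢ[ℝ] lpMeas ℝ ℝ (invariantSigma Γ m) ∞ m :=
    ⟨P.toLinearMap.codRestrict _ hmem, fun φ => P.norm_map φ⟩
  have hsurj : Function.Surjective e₀ := by
    intro f
    obtain ⟨F, hFm, hfF⟩ := lpMeas.aestronglyMeasurable f
    have hF : Measurable[invariantSigma Γ m] F := hFm.measurable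
    have hF' : Measurable F := hF.mono invariantSigma_le le_rfl
    have hFb : ∀ᵐ p ∂m, |F p| ≤ ‖(f : Lp ℝ ∞ m)‖ := by
      filter_upwards [(Lp_top_norm_le_iff (f : Lp ℝ ∞ m) (norm_nonneg _)).1 le_rfl, hfF]
        with p h1 h2
      rwa [← h2]
    have hφ := hΔ.memLp_restrict hF' hFb
    refine ⟨hφ.toLp _, Subtype.ext (Lp.ext ?_)⟩
    refine (hP _ hφ).trans (Filter.EventuallyEq.trans ?_ hfF.symm)
    filter_upwards [hΔ.ae_restrict_eq hq (ae_invariant_of_measurable hF)] with p ⟨y, hy, hpy⟩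
    rw [hpy.orbitSum_eq, hy]
  exact ⟨LinearIsometryEquiv.ofSurjective e₀ hsurj, fun φ => hP' φ⟩

end InducedAction

/-! ### The measure ν̃ and the fibre over the identity -/

theorem MeetsIdentityFibre.ae_exists_isOrbitPoint {G X : Type*} [Group G] {Γ : Subgroup G}
    [MulAction Γ X] [MeasurableSpace X] {ν : Measure X} {Δ : Set (G × X)}
    (hν : MeetsIdentityFibre Γ ν Δ) :
    ∀ᵐ x ∂ν, ∃ y : Δ, IsOrbitPoint (Γ := Γ) Δ ((1 : G), x) y :=
  hν.mono fun _ hx => exists_isOrbitPoint_iff.2 hx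

section IdentityFibre

variable {G X : Type*} [Group G] {Γ : Subgroup G} [Countable Γ] [MulAction Γ X]
  [MeasurableSpace G] [MeasurableSpace X] [MeasurableMul₂ G] [MeasurableSMul₂ Γ X]
  {ν : Measure X} {Δ : Set (G × X)}

theorem MeetsIdentityFibre.lintegral_nuTilde (hν : MeetsIdentityFibre Γ ν Δ)
    (hΔ : MeasurableSet Δ) {u : Δ → ℝ≥0∞} (hu : Measurable u) {v : X → ℝ≥0∞}
    (huv : ∀ᵐ x ∂ν, ∀ y : Δ, IsOrbitPoint (Γ := Γ) Δ ((1 : G), x) y → u y = v x) :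
    ∫⁻ y, u y ∂nuTilde Γ ν Δ = ∫⁻ x, v x ∂ν := by
  have hK : Measurable fun x : X => orbitKernel Γ hΔ ((1 : G), x) :=
    (orbitKernel Γ hΔ).measurable.comp measurable_prodMk_left
  rw [nuTilde_eq_bind ν hΔ, Measure.lintegral_bind hK.aemeasurable hu.aemeasurable]
  refine lintegral_congr_ae ?_
  filter_upwards [huv, hν.ae_exists_isOrbitPoint] with x hx ⟨y, hy⟩
  rw [hy.orbitKernel_eq, lintegral_dirac' _ hu, hx y hy]

theorem MeetsIdentityFibre.isProbabilityMeasure_nuTilde [IsProbabilityMeasure ν]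
    (hν : MeetsIdentityFibre Γ ν Δ) (hΔ : MeasurableSet Δ) :
    IsProbabilityMeasure (nuTilde Γ ν Δ) := by
  constructor
  rw [← lintegral_one, hν.lintegral_nuTilde hΔ measurable_const (v := fun _ => 1)
    (ae_of_all _ fun _ _ _ => rfl), lintegral_one, measure_univ]

theorem MeetsIdentityFibre.ae_nuTilde (hν : MeetsIdentityFibre Γ ν Δ) (hΔ : MeasurableSet Δ)
    {p : Δ → Prop} (hp : MeasurableSet {y | p y})
    (h : ∀ᵐ x ∂ν, ∀ y : Δ, IsOrbitPoint (Γ := Γ) Δ ((1 : G), x) y → p y) :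
    ∀ᵐ y ∂nuTilde Γ ν Δ, p y := by
  change nuTilde Γ ν Δ {y | p y}ᶜ = 0
  rw [← lintegral_indicator_one hp.compl, hν.lintegral_nuTilde hΔ
    (measurable_one.indicator hp.compl) (v := fun _ => 0), lintegral_zero]
  filter_upwards [h] with x hx y hy
  exact Set.indicator_of_notMem (Set.notMem_compl_iff.2 (hx y hy)) _

theorem MeetsIdentityFibre.integral_nuTilde [IsProbabilityMeasure ν]
    (hν : MeetsIdentityFibre Γ ν Δ) (hΔ : MeasurableSet Δ) {u : Δ → ℝ} (hu : StronglyMeasurable u)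
    {C : ℝ} (hC : ∀ y, |u y| ≤ C) {v : X → ℝ}
    (huv : ∀ᵐ x ∂ν, ∀ y : Δ, IsOrbitPoint (Γ := Γ) Δ ((1 : G), x) y → u y = v x) :
    ∫ y, u y ∂nuTilde Γ ν Δ = ∫ x, v x ∂ν := by
  have hprob := hν.isProbabilityMeasure_nuTilde hΔ
  let K : Kernel X Δ := (orbitKernel Γ hΔ).comap (Prod.mk (1 : G)) measurable_prodMk_left
  have hK : nuTilde Γ ν Δ = (K ∘ₖ Kernel.const Unit ν) () := nuTilde_eq_bind ν hΔ
  have hint : Integrable u (nuTilde Γ ν Δ) :=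
    Integrable.of_bound hu.aestronglyMeasurable C (ae_of_all _ hC)
  rw [hK] at hint ⊢
  rw [Kernel.integral_comp hint]
  refine integral_congr_ae ?_
  change ∀ᵐ x ∂ν, _
  filter_upwards [huv, hν.ae_exists_isOrbitPoint] with x hx ⟨y, hy⟩
  change ∫ z, u z ∂orbitKernel Γ hΔ (1, x) = _
  rw [hy.orbitKernel_eq, integral_dirac' _ _ hu, hx y hy]

theorem MeetsIdentityFibre.hasSum_integral_nuTilde [IsProbabilityMeasure ν]
    (hν : MeetsIdentityFibre Γ ν Δ) (hΔ : MeasurableSet Δ) {φ : Δ → ℝ} (hφ : Measurable φ)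
    {C : ℝ} (hC : ∀ y, |φ y| ≤ C) :
    HasSum (fun γ : Γ => ∫ x, zeroExt φ (starAct γ ((1 : G), x)) ∂ν)
      (∫ y, φ y ∂nuTilde Γ ν Δ) := by
  have hprob := hν.isProbabilityMeasure_nuTilde hΔ
  have hemb := MeasurableEmbedding.subtype_coe hΔ
  have hm : ∀ γ : Γ, Measurable fun x : X => starAct γ ((1 : G), x) := fun γ =>
    (measurable_starAct γ).comp measurable_prodMk_left
  have hz : Measurable (zeroExt φ) := hemb.measurable_extend hφ measurable_const
  set M : Measure (G × X) := Measure.sum fun γ : Γ => ν.map fun x => starAct γ ((1 : G), x)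
  -- M itself may be infinite, but its mass on Δ is that of ν̃, namely 1, and the extended function
  -- vanishes off Δ.
  have hMΔ : M Δ ≠ ∞ := by
    have h1 : nuTilde Γ ν Δ Set.univ = M (Subtype.val '' Set.univ) := hemb.comap_apply _ _
    rw [Set.image_univ, Subtype.range_coe, measure_univ] at h1
    simp [← h1]
  have hint : Integrable (zeroExt φ) M := by
    have h1 : IntegrableOn (zeroExt φ) Δ M := by
      refine Measure.integrableOn_of_bounded (M := C) hMΔ hz.aestronglyMeasurable ?_
      refine (ae_restrict_iff' hΔ).2 (ae_of_all _ fun p hp => ?_)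
      rw [show zeroExt φ p = φ ⟨p, hp⟩ from zeroExt_coe φ ⟨p, hp⟩]
      exact hC _
    exact h1.integrable_of_forall_notMem_eq_zero fun p hp => zeroExt_of_notMem φ hp
  have h1 : ∫ y, φ y ∂nuTilde Γ ν Δ = ∫ p, zeroExt φ p ∂M := by
    rw [← setIntegral_eq_integral_of_forall_compl_eq_zero (s := Δ)
      fun p hp => zeroExt_of_notMem φ hp, ← integral_subtype_comap hΔ]
    exact integral_congr_ae (ae_of_all _ fun y => (zeroExt_coe φ y).symm)
  rw [h1]
  have h2 := hasSum_integral_measure hint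
  simp_rw [fun γ => integral_map (hm γ).aemeasurable (hz.aestronglyMeasurable (μ := ν.map _))] at h2
  exact h2

/-- Translating the orbit of (e, x) by g gives the orbit of (g, x), so the convolution only sees the
law of (g, x). -/
theorem MeetsIdentityFibre.actConv_nuTilde [IsProbabilityMeasure ν]
    (hν : MeetsIdentityFibre Γ ν Δ) (hΔ : MeasurableSet Δ) (ρ : Measure G) [SFinite ρ] :
    actConv (inducedKernel Γ hΔ) ρ (nuTilde Γ ν Δ) = (ρ.prod ν).bind (orbitKernel Γ hΔ) := by
  have hprob := hν.isProbabilityMeasure_nuTilde hΔ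
  ext A hA
  unfold actConv
  rw [Measure.bind_apply hA (Kernel.aemeasurable _), Measure.bind_apply hA (Kernel.aemeasurable _),
    lintegral_prod _ ((inducedKernel Γ hΔ).measurable_coe hA).aemeasurable,
    lintegral_prod _ ((orbitKernel Γ hΔ).measurable_coe hA).aemeasurable]
  refine lintegral_congr fun g => ?_
  refine hν.lintegral_nuTilde hΔ
    (((inducedKernel Γ hΔ).measurable_coe hA).comp measurable_prodMk_left)
    (ae_of_all _ fun x y hy => ?_)
  rw [Function.comp_apply, hy.inducedKernel_eq, mul_one]

/-- The points (γ, x) and (e, γx) lie on one orbit, so stationarity passes from ν to ν̃. -/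
theorem MeetsIdentityFibre.actConv_map_subtype_nuTilde [IsProbabilityMeasure ν]
    (hν : MeetsIdentityFibre Γ ν Δ) (hΔ : MeasurableSet Δ) (μ : Measure Γ) [SFinite μ]
    (hμ : actConv (actionKernel Γ X) μ ν = ν) :
    actConv (inducedKernel Γ hΔ) (μ.map (Subtype.val : Γ → G)) (nuTilde Γ ν Δ) =
      nuTilde Γ ν Δ := by
  have hK : Measurable fun x : X => orbitKernel Γ hΔ ((1 : G), x) :=
    (orbitKernel Γ hΔ).measurable.comp measurable_prodMk_left
  rw [hν.actConv_nuTilde hΔ]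
  conv_rhs => rw [nuTilde_eq_bind ν hΔ, ← hμ]
  ext A hA
  have hKA := (orbitKernel Γ hΔ).measurable_coe hA
  have hKA1 : Measurable fun x : X => orbitKernel Γ hΔ ((1 : G), x) A :=
    hKA.comp measurable_prodMk_left
  rw [Measure.bind_apply hA (Kernel.aemeasurable _), Measure.bind_apply hA hK.aemeasurable,
    actConv_actionKernel, lintegral_map hKA1 measurable_smul_prod,
    lintegral_prod _ hKA.aemeasurable,
    lintegral_prod (fun q : Γ × X => orbitKernel Γ hΔ ((1 : G), q.1 • q.2) A)
      (hKA1.comp measurable_smul_prod).aemeasurable,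
    lintegral_map hKA.lintegral_prod_right' measurable_subtype_coe]
  refine lintegral_congr fun γ => lintegral_congr fun x => ?_
  have : starAct γ ((γ : G), x) = ((1 : G), γ • x) := by simp [starAct]
  rw [← orbitKernel_starAct hΔ γ ((γ : G), x), this]

theorem IsStarFundamentalDomain.ae_bind_orbitKernel_iff {m : Measure (G × X)}
    (hΔ : IsStarFundamentalDomain Γ m Δ)
    (hq : ∀ γ : Γ, Measure.QuasiMeasurePreserving (starAct γ) m m) {A : Set Δ}
    (hA : MeasurableSet A) :
    (m.bind (orbitKernel Γ hΔ.measurableSet)) A = 0 ↔ onDomain m Δ A = 0 := by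
  rw [measure_eq_zero_iff_ae_notMem (μ := onDomain m Δ), hΔ.ae_onDomain_iff_ae hq,
    Measure.bind_apply hA (Kernel.aemeasurable _), lintegral_eq_zero_iff
    ((orbitKernel Γ hΔ.measurableSet).measurable_coe hA)]
  have horb := hΔ.ae_exists_isOrbitPoint hq (Q := fun _ => True) (ae_of_all _ fun _ => trivial)
  refine Filter.eventually_congr ?_
  filter_upwards [horb] with p ⟨y, _, hy⟩
  rw [hy.orbitKernel_eq, Pi.zero_apply, Measure.dirac_apply' _ hA, Set.indicator_apply_eq_zero]
  constructor
  · exact fun h => ⟨y, fun hyA => one_ne_zero (h hyA), hy⟩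
  · rintro ⟨z, hzA, γ, hγ, hγ'⟩ hyA
    obtain ⟨γ₁, h1, -⟩ := hy
    have : γ₁ = γ := hγ' γ₁ (h1 ▸ y.2)
    subst this
    exact absurd (Subtype.ext (h1.symm.trans hγ) ▸ hyA) hzA

theorem MeetsIdentityFibre.poissonTransform_inducedKernel [MeasurableSingletonClass G]
    [MeasurableSingletonClass X] [IsProbabilityMeasure ν] (hν : MeetsIdentityFibre Γ ν Δ)
    (hΔ : MeasurableSet Δ) {ρ : Measure G} [SFinite ρ]
    (hq : ∀ γ : Γ, Measure.QuasiMeasurePreserving (starAct γ) (ρ.prod ν) (ρ.prod ν))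
    {φ : Δ → ℝ} {F : G × X → ℝ} (hF : Measurable F)
    (hinv : ∀ (γ : Γ) p, F (starAct γ p) = F p) {C : ℝ} (hC : ∀ p, |F p| ≤ C)
    (hFφ : ∀ᵐ p ∂ρ.prod ν, ∃ y : Δ, F p = φ y ∧ IsOrbitPoint (Γ := Γ) Δ p y) :
    ∀ᵐ g ∂ρ, poissonTransform (inducedKernel Γ hΔ) (nuTilde Γ ν Δ) φ g =
      ∫ x, F (g, x) ∂ν := by
  obtain ⟨S, hSae, hSm, hS⟩ := hFφ.exists_measurable_mem
  -- The good set is made invariant because, for y on the orbit of (e, x), the translate of y by g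
  -- is some γ ⋆ (g, x) rather than (g, x) itself.
  have hS' : ∀ᵐ p ∂ρ.prod ν, ∀ γ : Γ, starAct γ p ∈ S := ae_all_iff.2 fun γ => (hq γ).ae hSae
  have hSm' : MeasurableSet {p : G × X | ∀ γ : Γ, starAct γ p ∈ S} := by
    rw [Set.ofPred_forall]
    exact MeasurableSet.iInter fun γ => measurable_starAct γ hSm
  have htrans : ∀ g : G, Measurable fun y : Δ => (g * y.1.1, y.1.2) := fun g =>
    (measurable_subtype_coe.fst.const_mul g).prodMk measurable_subtype_coe.snd
  have hmove : ∀ (g : G) (x : X) (y : Δ), IsOrbitPoint (Γ := Γ) Δ ((1 : G), x) y →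
      ∃ γ : Γ, (g * y.1.1, y.1.2) = starAct γ (g, x) := by
    rintro g x y ⟨γ, h1, -⟩
    refine ⟨γ, ?_⟩
    rw [← h1, ← starAct_mul_left γ g ((1 : G), x), mul_one]
  filter_upwards [Measure.ae_ae_of_ae_prod hS'] with g hg
  have h1 : ∀ᵐ y ∂nuTilde Γ ν Δ, ∀ γ : Γ, starAct γ (g * y.1.1, y.1.2) ∈ S := by
    refine hν.ae_nuTilde hΔ (p := fun y => ∀ γ : Γ, starAct γ (g * y.1.1, y.1.2) ∈ S)
      (htrans g hSm') ?_
    filter_upwards [hg] with x hx y hy γ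
    obtain ⟨γ', h⟩ := hmove g x y hy
    rw [h, ← starAct_mul]
    exact hx _
  have h2 : poissonTransform (inducedKernel Γ hΔ) (nuTilde Γ ν Δ) φ g =
      ∫ y, F (g * y.1.1, y.1.2) ∂nuTilde Γ ν Δ := by
    refine integral_congr_ae ?_
    filter_upwards [h1] with y hy
    obtain ⟨z, hz1, hz2⟩ := hS _ (by simpa using hy 1)
    rw [inducedKernel_apply, hz2.orbitKernel_eq, integral_dirac, hz1]
  rw [h2]
  refine hν.integral_nuTilde hΔ (hF.comp (htrans g)).stronglyMeasurable (fun y => hC _)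
    (ae_of_all _ fun x y hy => ?_)
  obtain ⟨γ, h⟩ := hmove g x y hy
  rw [Function.comp_apply, h, hinv]

end IdentityFibre

/-! ### From the Γ-boundary to the G-boundary -/

theorem memLp_top_of_absolutelyContinuous {α : Type*} [MeasurableSpace α] {m₁ m₂ : Measure α}
    (h : m₁ ≪ m₂) {φ : α → ℝ} (hφ : MemLp φ ∞ m₂) : MemLp φ ∞ m₁ := by
  refine ⟨hφ.1.mono_ac h, ?_⟩
  have := hφ.2
  rw [eLpNorm_exponent_top] at this ⊢
  exact (eLpNormEssSup_mono_measure φ h).trans_lt this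

theorem abs_integral_le_of_ae {α : Type*} [MeasurableSpace α] {m : Measure α}
    [IsProbabilityMeasure m] {u : α → ℝ} {C : ℝ} (h : ∀ᵐ x ∂m, |u x| ≤ C) :
    |∫ x, u x ∂m| ≤ C := by
  have h1 : ∀ᵐ x ∂m, ‖u x‖ ≤ C := h
  simpa using norm_integral_le_of_norm_le_const h1

/-- This identity turns fibre averages along the coset gΓ into the Γ-Poisson transform of F(g, ·).
-/
theorem invariant_apply_mul {G X : Type*} [Group G] {Γ : Subgroup G} [MulAction Γ X]
    {F : G × X → ℝ} (hinv : ∀ (γ : Γ) p, F (starAct γ p) = F p)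
    (g : G) (γ : Γ) (x : X) : F (g * γ, x) = F (g, γ • x) := by
  rw [← hinv γ]
  simp [starAct]

section InducedBoundary

variable {G X : Type*} [Group G] {Γ : Subgroup G} [Countable Γ] [MulAction Γ X]
  [MeasurableSpace G] [MeasurableSpace X] [MeasurableSMul₂ Γ X]
  {ν : Measure X} {Δ : Set (G × X)} {ρ : Measure G} {μ ρΓ : Measure Γ}

/-- The averages of a bounded invariant function over the fibres determine its norm. -/
theorem IsPoissonBoundary.ae_abs_le_of_invariant
    (hX : IsPoissonBoundary Measure.count ρΓ μ (actionKernel Γ X) ν)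
    [IsProbabilityMeasure ρΓ] (hρΓ : ∀ γ, ρΓ {γ} ≠ 0) [SFinite ρ]
    (hr : ∀ γ : Γ, Measure.QuasiMeasurePreserving (fun g : G => g * γ) ρ ρ)
    {F : G × X → ℝ} (hF : Measurable F) (hinv : ∀ (γ : Γ) p, F (starAct γ p) = F p)
    {K C : ℝ} (hK : ∀ p, |F p| ≤ K) (hC : 0 ≤ C) (h : ∀ᵐ g ∂ρ, |∫ x, F (g, x) ∂ν| ≤ C) :
    ∀ᵐ p ∂ρ.prod ν, |F p| ≤ C := by
  have := hX.prob
  rw [Measure.ae_prod_iff_ae_ae (measurableSet_le hF.abs measurable_const)]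
  have h' : ∀ᵐ g ∂ρ, ∀ γ : Γ, |∫ x, F (g * γ, x) ∂ν| ≤ C := ae_all_iff.2 fun γ => (hr γ).ae h
  filter_upwards [h'] with g hg
  simp only [invariant_apply_mul hinv] at hg
  have h1 := hX.ae_abs_le (u := fun x => F (g, x))
    (hF.comp measurable_prodMk_left).stronglyMeasurable (ae_of_all _ fun x => hK _) hC hg
  simpa using ae_smul_of_ae_actConv hρΓ h1 1

variable [MeasurableSingletonClass G]

/-- The averages of a bounded invariant function over the fibres form a harmonic function. -/
theorem isHarmonic_of_invariant [IsProbabilityMeasure ν] [SFinite μ]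
    (hμν : actConv (actionKernel Γ X) μ ν = ν)
    (hr : ∀ γ : Γ, Measure.QuasiMeasurePreserving (fun g : G => g * γ) ρ ρ)
    {F : G × X → ℝ} (hF : Measurable F) (hinv : ∀ (γ : Γ) p, F (starAct γ p) = F p)
    {K : ℝ} (hK : ∀ p, |F p| ≤ K) {f : G → ℝ} (hf : ∀ᵐ g ∂ρ, f g = ∫ x, F (g, x) ∂ν) :
    IsHarmonic ρ (μ.map (Subtype.val : Γ → G)) f := by
  have hemb : MeasurableEmbedding (Subtype.val : Γ → G) :=
    MeasurableEmbedding.subtype_coe (Set.to_countable (Γ : Set G)).measurableSet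
  have h' : ∀ᵐ g ∂ρ, ∀ γ : Γ, f (g * γ) = ∫ x, F (g * γ, x) ∂ν :=
    ae_all_iff.2 fun γ => (hr γ).ae hf
  filter_upwards [hf, h'] with g hg hg'
  have hFg : Measurable fun x => F (g, x) := hF.comp measurable_prodMk_left
  have hint : Integrable (fun q : Γ × X => F (g, q.1 • q.2)) (μ.prod ν) := by
    have h1 : Integrable (fun x => F (g, x)) ν :=
      Integrable.of_bound hFg.aestronglyMeasurable K (ae_of_all _ fun x => hK _)
    rw [← hμν, actConv_actionKernel] at h1
    exact h1.comp_measurable measurable_smul_prod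
  simp only [hemb.integral_map, hg', hg, invariant_apply_mul hinv]
  conv_lhs => rw [← hμν, actConv_actionKernel, integral_map measurable_smul_prod.aemeasurable
    hFg.aestronglyMeasurable, integral_prod _ hint]

variable [MeasurableMul₂ G]

/-- Every bounded harmonic function on `G` is the fibre average of a bounded function that is
invariant almost everywhere. -/
theorem IsPoissonBoundary.exists_invariant_of_isHarmonic
    [MeasurableSpace.CountablyGenerated X]
    (hX : IsPoissonBoundary Measure.count ρΓ μ (actionKernel Γ X) ν)
    [IsProbabilityMeasure ρΓ] (hρΓ : ∀ γ, ρΓ {γ} ≠ 0) [SFinite ρ]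
    (hr : ∀ γ : Γ, Measure.QuasiMeasurePreserving (fun g : G => g * γ) ρ ρ)
    {f : G → ℝ} (hf : Measurable f) {C : ℝ} (hC0 : 0 ≤ C) (hC : ∀ᵐ g ∂ρ, |f g| ≤ C)
    (hh : IsHarmonic ρ (μ.map (Subtype.val : Γ → G)) f) :
    ∃ F : G × X → ℝ, Measurable F ∧ (∀ p, |F p| ≤ C) ∧
      (∀ᵐ p ∂ρ.prod ν, ∀ γ : Γ, F (starAct γ p) = F p) ∧
      ∀ᵐ g ∂ρ, ∫ x, F (g, x) ∂ν = f g := by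
  have := hX.prob
  have hemb : MeasurableEmbedding (Subtype.val : Γ → G) :=
    MeasurableEmbedding.subtype_coe (Set.to_countable (Γ : Set G)).measurableSet
  obtain ⟨F, hFm, hFC, hF⟩ := hX.exists_measurable_transform_eq hρΓ
    (h := fun (g : G) (γ : Γ) => f (g * γ)) (fun γ => hf.comp (measurable_mul_const _)) hC0
  have hgood : ∀ᵐ g ∂ρ, ∀ γ : Γ, ∫ x, F (g, γ • x) ∂ν = f (g * γ) := by
    have h1 : ∀ᵐ g ∂ρ, ∀ γ : Γ, |f (g * γ)| ≤ C := ae_all_iff.2 fun γ => (hr γ).ae hC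
    have h2 : ∀ᵐ g ∂ρ, ∀ γ : Γ, f (g * γ) = ∫ h, f (g * γ * h) ∂(μ.map (Subtype.val : Γ → G)) :=
      ae_all_iff.2 fun γ => (hr γ).ae hh
    filter_upwards [h1, h2] with g hg1 hg2
    refine hF g hg1 fun γ => ?_
    rw [hg2, hemb.integral_map]
    simp only [Subgroup.coe_mul, mul_assoc]
  refine ⟨F, hFm, hFC, ae_all_iff.2 fun γ => ?_, ?_⟩
  · have hms : MeasurableSet {p : G × X | F (starAct γ p) = F p} :=
      measurableSet_eq_fun (hFm.comp (measurable_starAct γ)) hFm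
    rw [Measure.ae_prod_iff_ae_ae hms]
    filter_upwards [hgood, (hr γ⁻¹).ae hgood] with g h1 h2
    have hm1 : Measurable fun x => F (g * ((γ⁻¹ : Γ) : G), γ • x) :=
      hFm.comp (measurable_const.prodMk (measurable_const_smul γ))
    have hm2 : Measurable fun x => F (g, x) := hFm.comp measurable_prodMk_left
    have hint : ∀ {u : X → ℝ}, Measurable u → (∀ x, |u x| ≤ C) → ∀ γ' : Γ,
        Integrable (fun x => u (γ' • x)) ν := fun hu hb γ' =>
      Integrable.of_bound (hu.comp (measurable_const_smul γ')).aestronglyMeasurable C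
        (ae_of_all _ fun x => hb _)
    -- Both terms have the Γ-transform γ' ↦ f(gγ'), so the difference has transform zero; the bound
    -- is applied with constant 0.
    have h3 := hX.ae_abs_le (u := fun x => F (g * ((γ⁻¹ : Γ) : G), γ • x) - F (g, x))
      (hm1.sub hm2).stronglyMeasurable (K := C + C)
      (ae_of_all _ fun x => (abs_sub _ _).trans (add_le_add (hFC _) (hFC _))) le_rfl
      (fun γ' => by
        rw [integral_sub (hint hm1 (fun _ => hFC _) γ') (hint hm2 (fun _ => hFC _) γ'), h1]
        simp only [← mul_smul]
        rw [h2, Subgroup.coe_mul, ← mul_assoc, Subgroup.coe_inv, inv_mul_cancel_right, sub_self,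
          abs_zero])
    filter_upwards [ae_smul_of_ae_actConv hρΓ h3 1] with x hx
    rw [one_smul, abs_nonpos_iff, sub_eq_zero] at hx
    exact hx
  · filter_upwards [hgood] with g hg
    simpa using hg 1

theorem MeetsIdentityFibre.isPoissonBoundary_nuTilde [MeasurableSingletonClass X]
    [MeasurableSpace.CountablyGenerated X]
    (hX : IsPoissonBoundary Measure.count ρΓ μ (actionKernel Γ X) ν)
    [IsProbabilityMeasure ρΓ] (hρΓ : ∀ γ, ρΓ {γ} ≠ 0) [SFinite μ]
    [IsProbabilityMeasure ρ] {lam : Measure G} (hρ : ρ ≪ lam) (hρ' : lam ≪ ρ)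
    (hr : ∀ γ : Γ, Measure.QuasiMeasurePreserving (fun g : G => g * γ) ρ ρ)
    (hq : ∀ γ : Γ, Measure.QuasiMeasurePreserving (starAct γ) (ρ.prod ν) (ρ.prod ν))
    (hl : ∀ g : G, Measure.QuasiMeasurePreserving (fun p : G × X => (g * p.1, p.2))
      (ρ.prod ν) (ρ.prod ν))
    (hΔ : IsStarFundamentalDomain Γ (ρ.prod ν) Δ) (hν : MeetsIdentityFibre Γ ν Δ) :
    actConv (inducedKernel Γ hΔ.measurableSet) ρ (nuTilde Γ ν Δ) ≪ onDomain (ρ.prod ν) Δ ∧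
    onDomain (ρ.prod ν) Δ ≪ actConv (inducedKernel Γ hΔ.measurableSet) ρ (nuTilde Γ ν Δ) ∧
    IsPoissonBoundary lam ρ (μ.map (Subtype.val : Γ → G))
      (inducedKernel Γ hΔ.measurableSet) (nuTilde Γ ν Δ) := by
  have := hX.prob
  have hprob := hν.isProbabilityMeasure_nuTilde hΔ.measurableSet
  set κ := inducedKernel Γ hΔ.measurableSet with hκ
  set m := ρ.prod ν with hm
  set M := actConv κ ρ (nuTilde Γ ν Δ) with hM
  have hMeq : M = m.bind (orbitKernel Γ hΔ.measurableSet) := hν.actConv_nuTilde hΔ.measurableSet ρ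
  have hac1 : M ≪ onDomain m Δ := Measure.AbsolutelyContinuous.mk fun A hA h => by
    rwa [hMeq, hΔ.ae_bind_orbitKernel_iff hq hA]
  have hac2 : onDomain m Δ ≪ M := Measure.AbsolutelyContinuous.mk fun A hA h => by
    rwa [hMeq, hΔ.ae_bind_orbitKernel_iff hq hA] at h
  refine ⟨hac1, hac2, hprob, ?_,
    hν.actConv_map_subtype_nuTilde hΔ.measurableSet μ hX.invariant, ?_⟩
  · have hna := hΔ.isNearAction_inducedKernel hq hl
    exact ⟨fun g => hac1.ae_le (hna.point g), fun g A hA h => hac1.ae_le (hna.null g A hA (hac2 h)),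
      hac1.ae_le hna.one, fun g h => hac1.ae_le (hna.mul g h)⟩
  have hT : ∀ φ : Δ → ℝ, MemLp φ ∞ M → ∃ F : G × X → ℝ, Measurable F ∧
      (∀ (γ : Γ) p, F (starAct γ p) = F p) ∧ (∃ C, ∀ p, |F p| ≤ C) ∧
      (∀ᵐ p ∂m, ∃ y : Δ, F p = φ y ∧ IsOrbitPoint (Γ := Γ) Δ p y) ∧
      ∀ᵐ g ∂ρ, poissonTransform κ (nuTilde Γ ν Δ) φ g = ∫ x, F (g, x) ∂ν := by
    intro φ hφ
    obtain ⟨F, h1, h2, ⟨C, h3⟩, h4⟩ :=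
      hΔ.exists_invariant_lift hq (memLp_top_of_absolutelyContinuous hac2 hφ)
    exact ⟨F, h1, h2, ⟨C, h3⟩, h4,
      hν.poissonTransform_inducedKernel hΔ.measurableSet hq h1 h2 h3 h4⟩
  have hFint : ∀ {F : G × X → ℝ}, Measurable F → (∃ C, ∀ p, |F p| ≤ C) → ∀ g,
      Integrable (fun x => F (g, x)) ν := fun hF ⟨C, hC⟩ g =>
    Integrable.of_bound (hF.comp measurable_prodMk_left).aestronglyMeasurable C
      (ae_of_all _ fun x => hC _)
  have huniq : ∀ {p : G × X} {y z : Δ}, IsOrbitPoint (Γ := Γ) Δ p y →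
      IsOrbitPoint (Γ := Γ) Δ p z → y = z := by
    rintro p y z ⟨γ, h1, h2⟩ ⟨γ', h1', h2'⟩
    have : γ = γ' := h2' γ (h1 ▸ y.2)
    exact Subtype.ext (h1.symm.trans (this ▸ h1'))
  have hmemF : ∀ {F : G × X → ℝ} {f : G → ℝ}, Measurable F → (∃ C, ∀ p, |F p| ≤ C) →
      (∀ᵐ g ∂ρ, f g = ∫ x, F (g, x) ∂ν) → MemLp f ∞ lam := by
    rintro F f hF ⟨C, hC⟩ hf
    have h1 : StronglyMeasurable fun g => ∫ x, F (g, x) ∂ν :=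
      hF.stronglyMeasurable.integral_prod_right'
    have h2 : f =ᵐ[lam] fun g => ∫ x, F (g, x) ∂ν := hρ'.ae_le hf
    refine (memLp_top_of_bound h1.aestronglyMeasurable C (ae_of_all _ fun g => ?_)).ae_eq h2.symm
    exact abs_integral_le_of_ae (ae_of_all _ fun x => hC (g, x))
  obtain ⟨P, hP⟩ := exists_linearIsometry_of_ae (μ := M) (ν := lam)
    (poissonTransform κ (nuTilde Γ ν Δ))
    (fun φ hφ => by
      obtain ⟨F, hF, -, hb, -, hTF⟩ := hT φ hφ
      exact hmemF hF hb hTF)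
    (fun φ ψ h => by
      -- A null set of ρ * ν̃ is, for almost every g, null for κ(g, y) at ν̃-almost every y.
      have h1 := Measure.ae_ae_of_ae_prod (Measure.ae_ae_of_ae_bind (Kernel.aemeasurable _) h)
      refine hρ'.ae_le ?_
      filter_upwards [h1] with g hg
      refine integral_congr_ae ?_
      filter_upwards [hg] with y hy
      exact integral_congr_ae hy)
    (fun φ ψ hφ hψ => by
      obtain ⟨F₁, hF₁, -, hb₁, ho₁, hT₁⟩ := hT φ hφ
      obtain ⟨F₂, hF₂, -, hb₂, ho₂, hT₂⟩ := hT ψ hψ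
      obtain ⟨F, hF, -, hb, ho, hT₃⟩ := hT _ (hφ.add hψ)
      refine hρ'.ae_le ?_
      have h1 : ∀ᵐ p ∂m, F p = F₁ p + F₂ p := by
        filter_upwards [ho₁, ho₂, ho] with p ⟨y₁, e₁, o₁⟩ ⟨y₂, e₂, o₂⟩ ⟨y, e, o⟩
        rw [e, e₁, e₂, huniq o₁ o, huniq o₂ o, Pi.add_apply]
      filter_upwards [hT₁, hT₂, hT₃, Measure.ae_ae_of_ae_prod h1] with g h₁ h₂ h₃ h
      rw [Pi.add_apply, h₁, h₂, h₃, integral_congr_ae h, integral_add (hFint hF₁ hb₁ g)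
        (hFint hF₂ hb₂ g)])
    (fun c φ hφ => by
      obtain ⟨F₁, hF₁, -, hb₁, ho₁, hT₁⟩ := hT φ hφ
      obtain ⟨F, hF, -, hb, ho, hT₃⟩ := hT _ (hφ.const_smul c)
      refine hρ'.ae_le ?_
      have h1 : ∀ᵐ p ∂m, F p = c * F₁ p := by
        filter_upwards [ho₁, ho] with p ⟨y₁, e₁, o₁⟩ ⟨y, e, o⟩
        rw [e, e₁, huniq o₁ o, Pi.smul_apply, smul_eq_mul]
      filter_upwards [hT₁, hT₃, Measure.ae_ae_of_ae_prod h1] with g h₁ h₃ h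
      rw [Pi.smul_apply, h₁, h₃, integral_congr_ae h, integral_const_mul, smul_eq_mul])
    (fun φ hφ C hC => by
      obtain ⟨F, hF, hinv, ⟨K, hK⟩, ho, hTF⟩ := hT φ hφ
      constructor
      · intro h
        have h1 : ∀ᵐ g ∂ρ, |∫ x, F (g, x) ∂ν| ≤ C := by
          filter_upwards [hρ.ae_le h, hTF] with g h2 h3
          rwa [← h3]
        refine hac1.ae_le ((hΔ.ae_onDomain_iff_ae hq).2 ?_)
        filter_upwards [hX.ae_abs_le_of_invariant hρΓ hr hF hinv hK hC h1, ho] with p hp ⟨y, e, o⟩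
        exact ⟨y, e ▸ hp, o⟩
      · intro h
        have h1 : ∀ᵐ p ∂m, |F p| ≤ C := by
          filter_upwards [(hΔ.ae_onDomain_iff_ae hq).1 (hac2.ae_le h), ho]
            with p ⟨y₁, e₁, o₁⟩ ⟨y, e, o⟩
          rwa [e, huniq o o₁]
        refine hρ'.ae_le ?_
        filter_upwards [hTF, Measure.ae_ae_of_ae_prod h1] with g hg h2
        rw [hg]
        exact abs_integral_le_of_ae h2)
  refine ⟨P, hP, Set.Subset.antisymm ?_ ?_⟩
  · rintro _ ⟨φ, rfl⟩
    obtain ⟨F, hF, hinv, ⟨K, hK⟩, -, hTF⟩ := hT φ (Lp.memLp φ)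
    have h1 := hP φ (Lp.memLp φ)
    rw [Lp.toLp_coeFn] at h1
    refine hρ'.ae_le (isHarmonic_of_invariant hX.invariant hr hF hinv hK ?_)
    filter_upwards [hρ.ae_le h1, hTF] with g h2 h3
    rw [h2, h3]
  -- The preimage of f is the restriction to Δ of the F built from f; the lift of this restriction
  -- is again F almost everywhere.
  · intro f hf
    have hfm : Measurable f := (Lp.stronglyMeasurable f).measurable
    have hfC : ∀ᵐ g ∂ρ, |f g| ≤ ‖f‖ := hρ.ae_le ((Lp_top_norm_le_iff f (norm_nonneg _)).1 le_rfl)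
    obtain ⟨F, hF, hFC, hinv, hFf⟩ := hX.exists_invariant_of_isHarmonic hρΓ hr hfm
      (norm_nonneg f) hfC (hρ.ae_le hf)
    have hφ := memLp_top_of_absolutelyContinuous hac1
      (hΔ.memLp_restrict hF (ae_of_all _ hFC))
    refine ⟨hφ.toLp _, Lp.ext ((hP _ hφ).trans ?_)⟩
    obtain ⟨F', hF', -, -, ho, hTF⟩ := hT _ hφ
    have h1 : ∀ᵐ p ∂m, F' p = F p := by
      filter_upwards [ho, hΔ.ae_restrict_eq hq hinv] with p ⟨y₁, e₁, o₁⟩ ⟨y, e, o⟩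
      rw [e₁, e, huniq o o₁]
    refine hρ'.ae_le ?_
    filter_upwards [hTF, hFf, Measure.ae_ae_of_ae_prod h1] with g h2 h3 h4
    rw [h2, integral_congr_ae h4, h3]

end InducedBoundary

theorem quasiMeasurePreserving_prodMap {α β : Type*} [MeasurableSpace α] [MeasurableSpace β]
    {ρ : Measure α} {ν : Measure β} [SFinite ρ] [SFinite ν] {f : α → α} {g : β → β}
    (hf : Measure.QuasiMeasurePreserving f ρ ρ) (hg : Measure.QuasiMeasurePreserving g ν ν) :
    Measure.QuasiMeasurePreserving (fun p : α × β => (f p.1, g p.2)) (ρ.prod ν) (ρ.prod ν) := by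
  refine ⟨hf.measurable.prodMap hg.measurable, ?_⟩
  have := Measure.map_prod_map ρ ν hf.measurable hg.measurable
  exact this ▸ hf.absolutelyContinuous.prod hg.absolutelyContinuous

/-! ### Changing the fundamental domain on a null set -/

section ChangeOfDomain

variable {G X : Type*} [Group G] {Γ : Subgroup G} [Countable Γ] [MulAction Γ X]
  [MeasurableSpace G] [MeasurableSpace X]
  {ν : Measure X} {Δ : Set (G × X)} {ρ : Measure G}

/-- If the identity is an atom, a property that holds almost everywhere on G × X holds almost
everywhere on its fibre. -/
theorem meetsIdentityFibre_of_ne_zero [SFinite ν] (h1 : ρ {1} ≠ 0)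
    (hΔ : IsStarFundamentalDomain Γ (ρ.prod ν) Δ)
    (hq : ∀ γ : Γ, Measure.QuasiMeasurePreserving (starAct γ) (ρ.prod ν) (ρ.prod ν)) :
    MeetsIdentityFibre Γ ν Δ := by
  have horb : ∀ᵐ p ∂ρ.prod ν, ∃! γ : Γ, starAct γ p ∈ Δ := by
    filter_upwards [hΔ.ae_exists_isOrbitPoint hq (Q := fun _ => True)
      (ae_of_all _ fun _ => trivial)] with p ⟨y, _, hy⟩
    exact exists_isOrbitPoint_iff.1 ⟨y, hy⟩
  have h2 := Measure.ae_ae_of_ae_prod horb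
  by_contra h3
  exact h1 (measure_mono_null (Set.singleton_subset_iff.2 h3) h2)

variable [MeasurableSingletonClass G]

/-- Γ × X is ⋆-invariant, and null as a countable union of right translates of the null fibre over
e. Inside it, {e} × X is an exact fundamental domain and replaces the part of Δ there. -/
theorem exists_meetsIdentityFibre_of_eq_zero [SFinite ν] (h1 : ρ {1} = 0)
    (hr : ∀ γ : Γ, Measure.QuasiMeasurePreserving (fun g : G => g * γ) ρ ρ)
    (hΔ : IsStarFundamentalDomain Γ (ρ.prod ν) Δ) :
    ∃ Δ' : Set (G × X), IsStarFundamentalDomain Γ (ρ.prod ν) Δ' ∧ Δ' =ᵐ[ρ.prod ν] Δ ∧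
      MeetsIdentityFibre Γ ν Δ' := by
  set m := ρ.prod ν
  let Z : Set (G × X) := (Γ : Set G) ×ˢ Set.univ
  have hΓ : ρ (Γ : Set G) = 0 := by
    have h2 : (Γ : Set G) = ⋃ γ : Γ, {(γ : G)} := by ext g; simp
    rw [h2]
    refine measure_iUnion_null fun γ => ?_
    have h3 := (hr γ⁻¹).preimage_null h1
    convert h3 using 2
    ext g
    simp
  have hZ : m Z = 0 := by rw [Measure.prod_prod, hΓ, zero_mul]
  have hZm : MeasurableSet Z := (Set.to_countable (Γ : Set G)).measurableSet.prod MeasurableSet.univ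
  have hZinv : ∀ (γ : Γ) (p : G × X), starAct γ p ∈ Z ↔ p ∈ Z := by
    intro γ p
    simp only [Z, starAct, Set.mem_prod, SetLike.mem_coe, Set.mem_univ, and_true]
    exact Subgroup.mul_mem_cancel_right Γ (Γ.inv_mem γ.2)
  let Δ' : Set (G × X) := (Δ \ Z) ∪ ({1} : Set G) ×ˢ Set.univ
  have h1Z : ({1} : Set G) ×ˢ (Set.univ : Set X) ⊆ Z :=
    Set.prod_mono (Set.singleton_subset_iff.2 Γ.one_mem) subset_rfl
  have hmem : ∀ p, p ∉ Z → (p ∈ Δ' ↔ p ∈ Δ) := fun p hp =>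
    ⟨fun h => h.elim (fun h => h.1) fun h => absurd (h1Z h) hp, fun h => Or.inl ⟨h, hp⟩⟩
  have hmem' : ∀ (γ : Γ) (p : G × X), p ∉ Z → (p ∈ starAct γ '' Δ' ↔ p ∈ starAct γ '' Δ) := by
    intro γ p hp
    rw [mem_image_starAct, mem_image_starAct, hmem _ (by rwa [hZinv])]
  refine ⟨Δ', ⟨(hΔ.measurableSet.diff hZm).union
    ((measurableSet_singleton 1).prod MeasurableSet.univ), ?_, ?_⟩, ?_, ?_⟩
  · refine measure_mono_null (t := (Set.univ \ ⋃ γ : Γ, starAct γ '' Δ) ∪ Z) ?_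
      (measure_union_null hΔ.covers hZ)
    rintro p ⟨-, hp⟩
    by_cases hpZ : p ∈ Z
    · exact Or.inr hpZ
    · refine Or.inl ⟨trivial, fun h => hp ?_⟩
      simp only [Set.mem_iUnion] at h ⊢
      simpa only [hmem' _ p hpZ] using h
  · refine measure_mono_null (t := (Δ ∩ ⋃ γ : Γ, ⋃ _ : γ ≠ 1, starAct γ '' Δ) ∪ Z) ?_
      (measure_union_null hΔ.disjoint hZ)
    rintro p ⟨hpΔ, hp⟩
    by_cases hpZ : p ∈ Z
    · exact Or.inr hpZ
    · refine Or.inl ⟨(hmem p hpZ).1 hpΔ, ?_⟩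
      simp only [Set.mem_iUnion] at hp ⊢
      simpa only [hmem' _ p hpZ] using hp
  · filter_upwards [measure_eq_zero_iff_ae_notMem.1 hZ] with p hp
    exact propext (hmem p hp)
  · refine ae_of_all _ fun x => ⟨1, Or.inr (by simp), fun γ hγ => ?_⟩
    rcases hγ with h | h
    · exact absurd ((hZinv γ _).2 (h1Z (Set.mk_mem_prod rfl trivial))) h.2
    · simpa [starAct] using h.1

/-- A fundamental domain can be changed on a null set so that almost every orbit through the
fibre of the identity meets it exactly once. -/
theorem IsStarFundamentalDomain.exists_meetsIdentityFibre [SFinite ν]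
    (hΔ : IsStarFundamentalDomain Γ (ρ.prod ν) Δ)
    (hq : ∀ γ : Γ, Measure.QuasiMeasurePreserving (starAct γ) (ρ.prod ν) (ρ.prod ν))
    (hr : ∀ γ : Γ, Measure.QuasiMeasurePreserving (fun g : G => g * γ) ρ ρ) :
    ∃ Δ' : Set (G × X), IsStarFundamentalDomain Γ (ρ.prod ν) Δ' ∧ Δ' =ᵐ[ρ.prod ν] Δ ∧
      MeetsIdentityFibre Γ ν Δ' := by
  by_cases h1 : ρ {1} = 0
  · exact exists_meetsIdentityFibre_of_eq_zero h1 hr hΔ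
  · exact ⟨Δ, hΔ, Filter.EventuallyEq.rfl, meetsIdentityFibre_of_ne_zero h1 hΔ hq⟩

end ChangeOfDomain

theorem mainTheorem3
    {G : Type*} [Group G] [TopologicalSpace G] [IsTopologicalGroup G] [LocallyCompactSpace G]
    [SecondCountableTopology G] [T2Space G] [MeasurableSpace G] [BorelSpace G]
    -- `lam` is a right Haar measure on `G`, and `ρ` a probability measure equivalent to it
    (lam : Measure G) [lam.IsMulRightInvariant] [IsFiniteMeasureOnCompacts lam]
    [lam.IsOpenPosMeasure]
    (ρ : Measure G) [IsProbabilityMeasure ρ] (hρ : ρ ≪ lam) (hρ' : lam ≪ ρ)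
    -- a countable subgroup with a probability measure whose support generates it as a semigroup
    (Γ : Subgroup G) [Countable Γ] (μ : Measure Γ) [IsProbabilityMeasure μ]
    (hμ : Subsemigroup.closure {γ : Γ | μ {γ} ≠ 0} = ⊤)
    -- `(X, ν)` is the `(Γ, μ)`-Poisson boundary
    {X : Type*} [MeasurableSpace X] [StandardBorelSpace X] [MulAction Γ X] [MeasurableSMul₂ Γ X]
    (ν : Measure X) (ρΓ : Measure Γ) [IsProbabilityMeasure ρΓ] (hρΓ : ∀ γ : Γ, ρΓ {γ} ≠ 0)
    (hX : IsPoissonBoundary Measure.count ρΓ μ (actionKernel Γ X) ν)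
    (Δ : Set (G × X)) (hΔ : IsStarFundamentalDomain Γ (ρ.prod ν) Δ) :
    -- `L^∞(Δ)` is isometric to the space of invariant functions, by `φ ↦ ∑_γ (φ 1_Δ)(γ ⋆ ·)`
    (∃ e : Lp ℝ ∞ (onDomain (ρ.prod ν) Δ) ≃ₗᵢ[ℝ]
        lpMeas ℝ ℝ (invariantSigma Γ (ρ.prod ν)) ∞ (ρ.prod ν),
      ∀ φ : Lp ℝ ∞ (onDomain (ρ.prod ν) Δ),
        ((e φ : Lp ℝ ∞ (ρ.prod ν)) : G × X → ℝ) =ᵐ[ρ.prod ν]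
          fun p => ∑' γ : Γ, zeroExt φ (starAct γ p)) ∧
    -- the induced `G`-action on `Δ` and its formula on functions
    IsNearAction (inducedKernel Γ hΔ.measurableSet) (onDomain (ρ.prod ν) Δ) ∧
    (∀ (φ : Δ → ℝ) (g₀ : G), ∀ᵐ y ∂(onDomain (ρ.prod ν) Δ),
      ∫ z, φ z ∂(inducedKernel Γ hΔ.measurableSet (g₀, y)) =
        ∑' γ : Γ, zeroExt φ (starAct γ (g₀ * y.1.1, y.1.2))) ∧
    -- `Δ` with this action and the measure `ν̃` is the `G`-Poisson boundary
    (MeetsIdentityFibre Γ ν Δ →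
      (∀ φ : Δ → ℝ, Measurable φ → (∃ C : ℝ, ∀ y, |φ y| ≤ C) →
        HasSum (fun γ : Γ => ∫ x, zeroExt φ (starAct γ ((1 : G), x)) ∂ν)
          (∫ y, φ y ∂(nuTilde Γ ν Δ))) ∧
      actConv (inducedKernel Γ hΔ.measurableSet) ρ (nuTilde Γ ν Δ) ≪ onDomain (ρ.prod ν) Δ ∧
      onDomain (ρ.prod ν) Δ ≪ actConv (inducedKernel Γ hΔ.measurableSet) ρ (nuTilde Γ ν Δ) ∧
      IsPoissonBoundary lam ρ (μ.map (Subtype.val : Γ → G))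
        (inducedKernel Γ hΔ.measurableSet) (nuTilde Γ ν Δ)) ∧
    -- the condition at the identity holds after a change of `Δ` on a null set
    (∃ Δ' : Set (G × X), IsStarFundamentalDomain Γ (ρ.prod ν) Δ' ∧ Δ' =ᵐ[ρ.prod ν] Δ ∧
      MeetsIdentityFibre Γ ν Δ') := by
  have := hX.prob
  have hνq := quasiMeasurePreserving_smul_of_stationary μ ν hμ hX.invariant
  have hr : ∀ γ : G, Measure.QuasiMeasurePreserving (fun g : G => g * γ) ρ ρ := fun γ =>
    (measurePreserving_mul_right lam γ).quasiMeasurePreserving.mono hρ hρ'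
  -- Left translations need not preserve a right Haar measure, but they preserve its null sets.
  have hl : ∀ γ : G, Measure.QuasiMeasurePreserving (fun g : G => γ * g) ρ ρ := fun γ =>
    (quasiMeasurePreserving_mul_left lam γ).mono hρ hρ'
  have hq : ∀ γ : Γ, Measure.QuasiMeasurePreserving (starAct γ) (ρ.prod ν) (ρ.prod ν) := fun γ =>
    quasiMeasurePreserving_prodMap (hr (γ : G)⁻¹) (hνq γ)
  have hl' : ∀ g : G, Measure.QuasiMeasurePreserving (fun p : G × X => (g * p.1, p.2))
      (ρ.prod ν) (ρ.prod ν) := fun g =>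
    quasiMeasurePreserving_prodMap (hl g) (Measure.QuasiMeasurePreserving.id ν)
  refine ⟨hΔ.exists_linearIsometryEquiv hq, hΔ.isNearAction_inducedKernel hq hl',
    hΔ.ae_integral_inducedKernel hq hl', fun hmeets => ⟨?_, ?_⟩,
    hΔ.exists_meetsIdentityFibre hq fun γ => hr γ⟩
  · rintro φ hφ ⟨C, hC⟩
    exact hmeets.hasSum_integral_nuTilde hΔ.measurableSet hφ hC
  · exact hmeets.isPoissonBoundary_nuTilde hX hρΓ hρ hρ' (fun γ => hr γ) hq hl' hΔ
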